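/- Let $M\subset\mathbb R^d$ be a compact $d'$-dimensional submanifold of class $\mathcal C^2$, possibly with boundary $\partial M$, with the Riemannian metric inherited from $\mathbb R^d$; write $\rho$ for its geodesic distance (with $\rho=\infty$ between points that no curve in $M$ joins). Let $X_1,X_2,\dots$ be iid random vectors with support $M$ whose law has a density $f\ge 0$ of class $\mathcal C^2$ on $M$ with respect to the $d'$-dimensional Riemannian volume of $M$. Let $h=h_n>0$ with $h_n\to 0$, and suppose that there is a sequence $\beta_n\to\infty$ with $\beta_n h_n^2\to 0$ and $n h_n^{d'}/(\beta_n^2\log n)\to\infty$. For $x\in M$ put $$\hat f_{h,n}(x)=\frac{1}{n h_n^{d'}}\sum_{i=1}^n K\Big(\frac{\|x-X_i\|}{h_n}\Big),\qquad K(u)=\pi^{-d'/2}e^{-u^2}.$$ For a function $g$ on $M$ let $L_g(\lambda)=\{x\in M: g(x)\ge\lambda\}$. Let $\lambda>0$ be such that for every $x\in M$ with $f(x)=\lambda$ there is a sequence $a_j\to x$ of points of $M\setminus\partial M$ with $f(a_j)>\lambda$ for all $j$. For $r>0$ and $A\subset M$, the $r$-convex hull $C_r(A)$ is the intersection of the complements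 in $M$ of all open geodesic balls $\{y\in M:\rho(c,y)<r\}$, $c\in M$, that do not meet $A$; the set $A$ is called $r$-convex if $A=C_r(A)$. For $A,C\subset M$ let $$d_H(A,C)=\max\Big\{\sup_{a\in A}\inf_{c\in C}\rho(a,c),\ \sup_{c\in C}\inf_{a\in A}\rho(c,a)\Big\}\in[0,\infty]$$ (so that $d_H$ is $0$ if both sets are empty and $\infty$ if exactly one of them is). Assume that for some $r>0$ the set $L_f(\lambda)$ is $r$-convex and that, with probability one, $L_{\hat f_{h,n}}(\lambda)$ is $r$-convex for all sufficiently large $n$. Then, as $n\to\infty$, $$d_H\big(C_r(\{X_i: i\le n,\ \hat f_{h,n}(X_i)>\lambda\}),\ C_r(\{X_i: i\le n,\ f(X_i)>\lambda\})\big)\to 0\quad\text{a.s.}$$ and $$d_H\big(C_r(\{X_i: i\le n,\ \hat f_{h,n}(X_i)>\lambda\}),\ L_f(\lambda)\big)\to 0\quad\text{a.s.}$$ -/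

import Mathlib

open MeasureTheory ProbabilityTheory Filter Topology Set
open scoped ENNReal

namespace LevelSet

/-- The ambient space `ℝ^d`, with its Euclidean norm. -/
abbrev Euc (d : ℕ) : Type := EuclideanSpace ℝ (Fin d)

/-- `Φ` is a `C²` diffeomorphism between open subsets of `ℝ^d`. -/
def IsC2Diffeo {d : ℕ} (Φ : OpenPartialHomeomorph (Euc d) (Euc d)) : Prop :=
  ContDiffOn ℝ 2 Φ Φ.source ∧ ContDiffOn ℝ 2 Φ.symm Φ.target

/-- `p` is an interior point of the `m`-dimensional `C²` manifold `M ⊆ ℝ^d`: near `p`, some `C²`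
change of coordinates of `ℝ^d` straightens `M` to the coordinate subspace `ℝ^m × {0}`. -/
def IsInteriorPt {d : ℕ} (m : ℕ) (M : Set (Euc d)) (p : Euc d) : Prop :=
  p ∈ M ∧ ∃ Φ : OpenPartialHomeomorph (Euc d) (Euc d), IsC2Diffeo Φ ∧ p ∈ Φ.source ∧
    ∀ x ∈ Φ.source, x ∈ M ↔ ∀ i : Fin d, m ≤ i.val → Φ x i = 0

/-- `p` is a boundary point of the `m`-dimensional `C²` manifold `M ⊆ ℝ^d`: near `p`, some `C²`
change of coordinates of `ℝ^d` straightens `M` to the half-space of `ℝ^m × {0}` on which one of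
the `m` first coordinates is nonnegative, and that coordinate vanishes at `p`. -/
def IsBoundaryPt {d : ℕ} (m : ℕ) (M : Set (Euc d)) (p : Euc d) : Prop :=
  p ∈ M ∧ ∃ k : Fin d, k.val < m ∧
    ∃ Φ : OpenPartialHomeomorph (Euc d) (Euc d), IsC2Diffeo Φ ∧ p ∈ Φ.source ∧ Φ p k = 0 ∧
      ∀ x ∈ Φ.source, x ∈ M ↔ (∀ i : Fin d, m ≤ i.val → Φ x i = 0) ∧ 0 ≤ Φ x k

/-- `M ⊆ ℝ^d` is a compact `m`-dimensional submanifold of class `C²`, possibly with boundary. -/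
structure IsCompactC2Submanifold {d : ℕ} (m : ℕ) (M : Set (Euc d)) : Prop where
  dim_le : m ≤ d
  isCompact : IsCompact M
  locally_flat : ∀ p ∈ M, IsInteriorPt m M p ∨ IsBoundaryPt m M p

/-- The measure on `ℝ^d` carried by `M` with density `f` with respect to the `m`-dimensional
Riemannian volume of `M`, which is the `m`-dimensional Hausdorff measure, normalized so as to be
Lebesgue measure on `ℝ^m`. -/
noncomputable def densityLaw {d : ℕ} (m : ℕ) (M : Set (Euc d)) (f : Euc d → ℝ) :
    Measure (Euc d) :=
  (((Measure.euclideanHausdorffMeasure m : Measure (Euc d)).restrict M).withDensity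
    fun x => ENNReal.ofReal (f x))

/-- The geodesic distance of `M`: the infimum of the lengths of the `C¹` curves in `M` from `x`
to `y` (it is `∞` if there are none). -/
noncomputable def geodesicEDist {d : ℕ} (M : Set (Euc d)) (x y : Euc d) : ℝ≥0∞ :=
  ⨅ (γ : ℝ → Euc d) (_ : ContDiffOn ℝ 1 γ (Icc 0 1) ∧ MapsTo γ (Icc 0 1) M ∧ γ 0 = x ∧ γ 1 = y),
    ∫⁻ t in Icc (0 : ℝ) 1, ‖derivWithin γ (Icc 0 1) t‖ₑ

/-- The open geodesic ball of `M`. -/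
def geodesicBall {d : ℕ} (M : Set (Euc d)) (c : Euc d) (r : ℝ) : Set (Euc d) :=
  {y | y ∈ M ∧ geodesicEDist M c y < ENNReal.ofReal r}

/-- The `r`-convex hull in `M`: the intersection of the complements (in `M`) of all open geodesic
balls of radius `r` that do not meet `A`. -/
def rConvexHull {d : ℕ} (M : Set (Euc d)) (r : ℝ) (A : Set (Euc d)) : Set (Euc d) :=
  {x | x ∈ M ∧ ∀ c ∈ M, Disjoint (geodesicBall M c r) A → x ∉ geodesicBall M c r}

/-- `A` is `r`-convex in `M`. -/
def IsRConvex {d : ℕ} (M : Set (Euc d)) (r : ℝ) (A : Set (Euc d)) : Prop :=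
  A = rConvexHull M r A

/-- The Hausdorff distance with respect to the geodesic distance of `M`. It is `0` if both sets
are empty, and `∞` if just one of them is. -/
noncomputable def geodesicHausdorffEDist {d : ℕ} (M A C : Set (Euc d)) : ℝ≥0∞ :=
  max (⨆ a ∈ A, ⨅ c ∈ C, geodesicEDist M a c) (⨆ c ∈ C, ⨅ a ∈ A, geodesicEDist M c a)

/-- The upper level set in `M` of a function at the level `lam`. -/
def levelSet {d : ℕ} (M : Set (Euc d)) (g : Euc d → ℝ) (lam : ℝ) : Set (Euc d) :=
  {x | x ∈ M ∧ lam ≤ g x}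

/-- The density estimator with the Gaussian kernel `K(u) = π^(-m/2) exp(-u²)` and the bandwidth
`h`, at the point `x`, from the first `n` terms of the sample `X`. -/
noncomputable def densityEstimator {d : ℕ} (m : ℕ) (h : ℝ) (n : ℕ) (X : ℕ → Euc d)
    (x : Euc d) : ℝ :=
  1 / (n * h ^ m) *
    ∑ i ∈ Finset.range n, Real.pi ^ (-(m : ℝ) / 2) * Real.exp (-(‖x - X i‖ / h) ^ 2)

/-- The points among the first `n` terms of the sample `X` at which `g` exceeds the level. -/
def samplePointsAbove {d : ℕ} (n : ℕ) (X : ℕ → Euc d) (g : Euc d → ℝ) (lam : ℝ) :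
    Set (Euc d) :=
  {x | ∃ i < n, X i = x ∧ lam < g x}

end LevelSet

open LevelSet

namespace LevelSet

/-! On compact `M` the geodesic distance is uniformly small at small Euclidean distances, so it is
enough to show that both hulls approach `L_f(λ)` in the Euclidean sense.

The hulls are not too large: the sample points above the level lie in the corresponding level set,
which is `r`-convex, so their hull stays inside it. For `f` this is `L_f(λ)` itself; for the
estimator it is eventually contained in `{f ≥ λ - ε}`, which by compactness is close to `L_f(λ)`
(`exists_levelSet_sub_near`). The hulls are not too small: `L_f(λ)` is in the closure of the
interior points `b` of `M` with `f b > λ`. Near such a `b` the estimator eventually exceeds `λ`, and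
the sample is almost surely dense in `M`.

Hence only an upper bound of the estimator by `f + ε`, uniform on `M`, and a lower bound near
interior points are needed. This asymmetry is essential: at a boundary point the kernel sees only
part of the mass and the estimator is biased downwards.

The bias is controlled by projecting `M` locally onto a tangent space (`exists_tangent`). The
projection is a contraction with an almost contracting inverse, so Hausdorff measure compares with
Lebesgue measure, for which the kernel has mass exactly `h^m` (`eventually_smoothed_le`,
`eventually_le_smoothed`). The deviation from the mean is controlled by a Bernstein bound, a net of
polynomial size and Borel–Cantelli, since `n h^m / log n → ∞`
(`ae_eventually_abs_densityEstimator_sub_smoothed_le`). -/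

/-! ### Straightening charts -/

/-- The subspace `ℝ^m × {0}` of `ℝ^d`. -/
def coordSubspace (d m : ℕ) : Submodule ℝ (Euc d) where
  carrier := {z | ∀ i : Fin d, m ≤ i.val → z i = 0}
  add_mem' := fun {a b} ha hb i hi => by simp [ha i hi, hb i hi]
  zero_mem' := fun i _ => rfl
  smul_mem' := fun c a ha i hi => by simp [ha i hi]

theorem finrank_coordSubspace {d m : ℕ} (hmd : m ≤ d) :
    Module.finrank ℝ (coordSubspace d m) = m := by
  let e : coordSubspace d m ≃ₗ[ℝ] (Fin m → ℝ) :=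
    { toFun := fun z j => z.1 (Fin.castLE hmd j)
      map_add' := fun a b => by ext j; simp
      map_smul' := fun c a => by ext j; simp
      invFun := fun u => ⟨WithLp.toLp 2 fun i => if hi : i.val < m then u ⟨i.val, hi⟩ else 0,
        fun i hi => by simp [not_lt.2 hi]⟩
      left_inv := fun z => by
        ext i
        by_cases hi : i.val < m
        · simp [hi]
        · simpa [hi] using (z.2 i (not_lt.1 hi)).symm
      right_inv := fun u => by ext j; simp }
  simpa using e.finrank_eq

/-- Near each of its points, a `C²` submanifold is straightened by a `C²` diffeomorphism to a convex
subset of `ℝ^m × {0}`. -/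
theorem IsCompactC2Submanifold.exists_convex_chart {d m : ℕ} {M : Set (Euc d)}
    (hM : IsCompactC2Submanifold m M) {p : Euc d} (hp : p ∈ M) :
    ∃ Φ : OpenPartialHomeomorph (Euc d) (Euc d), IsC2Diffeo Φ ∧ p ∈ Φ.source ∧
      ∃ C : Set (Euc d), Convex ℝ C ∧ C ⊆ coordSubspace d m ∧ ∀ x ∈ Φ.source, x ∈ M ↔ Φ x ∈ C := by
  rcases hM.locally_flat p hp with ⟨-, Φ, hΦ, hpΦ, h⟩ | ⟨-, k, -, Φ, hΦ, hpΦ, -, h⟩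
  · exact ⟨Φ, hΦ, hpΦ, coordSubspace d m, (coordSubspace d m).convex, subset_rfl, h⟩
  · refine ⟨Φ, hΦ, hpΦ, {z | z ∈ coordSubspace d m ∧ 0 ≤ z k}, ?_, fun z hz => hz.1, h⟩
    intro x hx y hy a b ha hb hab
    refine ⟨(coordSubspace d m).convex hx.1 hy.1 ha hb hab, ?_⟩
    have h1 := mul_nonneg ha hx.2
    have h2 := mul_nonneg hb hy.2
    simpa using add_nonneg h1 h2

theorem IsC2Diffeo.contDiffAt {d : ℕ} {Φ : OpenPartialHomeomorph (Euc d) (Euc d)}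
    (hΦ : IsC2Diffeo Φ) {p : Euc d} (hp : p ∈ Φ.source) : ContDiffAt ℝ 2 Φ p :=
  hΦ.1.contDiffAt (Φ.open_source.mem_nhds hp)

theorem IsC2Diffeo.contDiffAt_symm {d : ℕ} {Φ : OpenPartialHomeomorph (Euc d) (Euc d)}
    (hΦ : IsC2Diffeo Φ) {q : Euc d} (hq : q ∈ Φ.target) : ContDiffAt ℝ 2 Φ.symm q :=
  hΦ.2.contDiffAt (Φ.open_target.mem_nhds hq)

/-- The derivative of a `C²` diffeomorphism at a point of its source is invertible. -/
theorem IsC2Diffeo.exists_deriv_equiv {d : ℕ} {Φ : OpenPartialHomeomorph (Euc d) (Euc d)}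
    (hΦ : IsC2Diffeo Φ) {p : Euc d} (hp : p ∈ Φ.source) :
    ∃ L : Euc d ≃L[ℝ] Euc d, HasStrictFDerivAt Φ (L : Euc d →L[ℝ] Euc d) p ∧
      HasStrictFDerivAt Φ.symm (L.symm : Euc d →L[ℝ] Euc d) (Φ p) := by
  have h1 := (hΦ.contDiffAt hp).hasStrictFDerivAt (by norm_num)
  have h2 := (hΦ.contDiffAt_symm (Φ.map_source hp)).hasStrictFDerivAt (by norm_num)
  have h21 : (fderiv ℝ Φ.symm (Φ p)).comp (fderiv ℝ Φ p) = ContinuousLinearMap.id ℝ (Euc d) := by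
    refine (h2.hasFDerivAt.comp p h1.hasFDerivAt).unique ((hasFDerivAt_id p).congr_of_eventuallyEq ?_)
    exact Φ.eventually_left_inverse hp
  have h12 : (fderiv ℝ Φ p).comp (fderiv ℝ Φ.symm (Φ p)) = ContinuousLinearMap.id ℝ (Euc d) := by
    have h1' : HasFDerivAt Φ (fderiv ℝ Φ p) (Φ.symm (Φ p)) := by
      rw [Φ.left_inv hp]; exact h1.hasFDerivAt
    refine (h1'.comp (Φ p) h2.hasFDerivAt).unique
      ((hasFDerivAt_id (Φ p)).congr_of_eventuallyEq ?_)
    exact Φ.eventually_right_inverse (Φ.map_source hp)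
  let L : Euc d ≃L[ℝ] Euc d := ContinuousLinearEquiv.equivOfInverse (fderiv ℝ Φ p)
    (fderiv ℝ Φ.symm (Φ p)) (fun x => congr($h21 x)) (fun x => congr($h12 x))
  exact ⟨L, h1, h2⟩

/-! ### Geodesic versus Euclidean distance -/

/-- The straight path between two points. -/
theorem exists_straight_path {E : Type*} [NormedAddCommGroup E] [NormedSpace ℝ E] (a b : E) :
    ∃ l : ℝ → E, ContDiff ℝ 1 l ∧ (∀ t, HasDerivAt l (b - a) t) ∧ l 0 = a ∧ l 1 = b ∧
      ∀ S : Set E, Convex ℝ S → a ∈ S → b ∈ S → ∀ t ∈ Icc (0 : ℝ) 1, l t ∈ S := by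
  refine ⟨fun t => a + t • (b - a), by fun_prop, fun t => ?_, by simp, by simp,
    fun S hS ha hb t ht => hS.add_smul_sub_mem ha hb ht⟩
  simpa using ((hasDerivAt_id t).smul_const (b - a)).const_add a

/-- The geodesic distance of `M` is locally small. -/
theorem IsCompactC2Submanifold.geodesicEDist_le_nhds {d m : ℕ} {M : Set (Euc d)}
    (hM : IsCompactC2Submanifold m M) {p : Euc d} (hp : p ∈ M) {ε : ℝ} (hε : 0 < ε) :
    ∃ U ∈ 𝓝 p, ∀ x ∈ U ∩ M, ∀ y ∈ U ∩ M, geodesicEDist M x y ≤ ENNReal.ofReal ε := by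
  obtain ⟨Φ, hΦ, hpΦ, C, hC, -, hMC⟩ := hM.exists_convex_chart hp
  have hq : Φ p ∈ Φ.target := Φ.map_source hpΦ
  have hcd := hΦ.contDiffAt_symm hq
  have hcont : ContinuousAt (fderiv ℝ Φ.symm) (Φ p) :=
    (hcd.fderiv_right (m := 1) (by norm_num)).continuousAt
  set K : ℝ := ‖fderiv ℝ Φ.symm (Φ p)‖ + 1 with hK
  have hKpos : 0 < K := by positivity
  have hev : ∀ᶠ u in 𝓝 (Φ p), ‖fderiv ℝ Φ.symm u‖ < K ∧ u ∈ Φ.target :=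
    (hcont.norm.eventually_lt_const (lt_add_one _)).and (Φ.open_target.mem_nhds hq)
  obtain ⟨ρ, hρ, hball⟩ := Metric.eventually_nhds_iff_ball.1 hev
  -- A segment in the ball of radius `ρ'` has length at most `2ρ'`, and `Φ.symm` stretches it by at
  -- most `K`; the product is at most `ε`.
  set ρ' := min ρ (ε / (2 * K)) with hρ'
  have hρ'pos : 0 < ρ' := lt_min hρ (by positivity)
  have hsub : Metric.ball (Φ p) ρ' ⊆ Metric.ball (Φ p) ρ := Metric.ball_subset_ball (min_le_left _ _)
  refine ⟨Φ.source ∩ Φ ⁻¹' Metric.ball (Φ p) ρ',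
    (Φ.continuousAt hpΦ).preimage_mem_nhds (Metric.ball_mem_nhds _ hρ'pos) |> inter_mem
      (Φ.open_source.mem_nhds hpΦ), ?_⟩
  rintro x ⟨⟨hxs, hxb⟩, hxM⟩ y ⟨⟨hys, hyb⟩, hyM⟩
  rw [mem_preimage] at hxb hyb
  obtain ⟨l, hl, hl', hl0, hl1, hconv⟩ := exists_straight_path (Φ x) (Φ y)
  have hseg : ∀ t ∈ Icc (0 : ℝ) 1, l t ∈ Metric.ball (Φ p) ρ' :=
    hconv _ (convex_ball _ _) hxb hyb
  have hsegC : ∀ t ∈ Icc (0 : ℝ) 1, l t ∈ C := hconv _ hC ((hMC x hxs).1 hxM) ((hMC y hys).1 hyM)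
  let γ : ℝ → Euc d := fun t => Φ.symm (l t)
  have hderiv : ∀ t ∈ Icc (0 : ℝ) 1, HasDerivAt γ
      (fderiv ℝ Φ.symm (l t) (Φ y - Φ x)) t := fun t ht => by
    have h2 := ((hΦ.contDiffAt_symm (hball _ (hsub (hseg t ht))).2).differentiableAt
      (by norm_num)).hasFDerivAt
    exact h2.comp_hasDerivAt t (hl' t)
  have hγ : ContDiffOn ℝ 1 γ (Icc 0 1) ∧ MapsTo γ (Icc 0 1) M ∧ γ 0 = x ∧ γ 1 = y := by
    refine ⟨fun t ht => ?_, fun t ht => ?_, ?_, ?_⟩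
    · refine ContDiffAt.contDiffWithinAt ?_
      have h2 := (hΦ.contDiffAt_symm (hball _ (hsub (hseg t ht))).2).of_le
        (show (1 : WithTop ℕ∞) ≤ 2 by norm_num)
      exact h2.comp t hl.contDiffAt
    · have ht' := (hball _ (hsub (hseg t ht))).2
      refine (hMC _ (Φ.map_target ht')).2 ?_
      rw [Φ.right_inv ht']
      exact hsegC t ht
    · simp [γ, hl0, Φ.left_inv hxs]
    · simp [γ, hl1, Φ.left_inv hys]
  refine (iInf₂_le γ hγ).trans ?_
  calc ∫⁻ t in Icc (0 : ℝ) 1, ‖derivWithin γ (Icc 0 1) t‖ₑ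
      ≤ ∫⁻ t in Icc (0 : ℝ) 1, ENNReal.ofReal ε := by
        refine setLIntegral_mono measurable_const fun t ht => ?_
        rw [(hderiv t ht).hasDerivWithinAt.derivWithin (uniqueDiffOn_Icc_zero_one t ht),
          ← ofReal_norm]
        refine ENNReal.ofReal_le_ofReal ?_
        have h1 : ‖Φ y - Φ x‖ ≤ 2 * ρ' := by
          rw [← dist_eq_norm]
          linarith [dist_triangle_right (Φ y) (Φ x) (Φ p), Metric.mem_ball.1 hxb,
            Metric.mem_ball.1 hyb]
        calc _ ≤ ‖fderiv ℝ Φ.symm (l t)‖ * ‖Φ y - Φ x‖ :=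
              ContinuousLinearMap.le_opNorm _ _
          _ ≤ K * (2 * ρ') := by
              gcongr
              exact (hball _ (hsub (hseg t ht))).1.le
          _ ≤ K * (2 * (ε / (2 * K))) := by gcongr; exact min_le_right _ _
          _ = ε := by field_simp
    _ = ENNReal.ofReal ε := by simp

/-- The geodesic distance of `M` is uniformly small at small Euclidean distances. -/
theorem IsCompactC2Submanifold.exists_geodesicEDist_le {d m : ℕ} {M : Set (Euc d)}
    (hM : IsCompactC2Submanifold m M) {ε : ℝ} (hε : 0 < ε) :
    ∃ δ > 0, ∀ x ∈ M, ∀ y ∈ M, dist x y < δ → geodesicEDist M x y ≤ ENNReal.ofReal ε := by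
  choose! U hU hUε using fun p (hp : p ∈ M) => hM.geodesicEDist_le_nhds hp hε
  obtain ⟨δ, hδ, h⟩ := lebesgue_number_lemma_of_metric (c := fun p : M => interior (U p))
    hM.isCompact (fun p => isOpen_interior)
    (fun p hp => mem_iUnion.2 ⟨⟨p, hp⟩, mem_interior_iff_mem_nhds.2 (hU p hp)⟩)
  refine ⟨δ, hδ, fun x hx y hy hxy => ?_⟩
  obtain ⟨p, hp⟩ := h x hx
  exact hUε p p.2 x ⟨interior_subset (hp (Metric.mem_ball_self hδ)), hx⟩ y
    ⟨interior_subset (hp (by rwa [Metric.mem_ball'])), hy⟩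

/-! ### Interior points and tangent spaces -/

/-- The interior points of `M` are dense in `M`. -/
theorem IsCompactC2Submanifold.mem_closure_interiorPt {d m : ℕ} {M : Set (Euc d)}
    (hM : IsCompactC2Submanifold m M) {p : Euc d} (hp : p ∈ M) :
    p ∈ closure {x | IsInteriorPt m M x} := by
  rcases hM.locally_flat p hp with h | ⟨-, k, hkm, Φ, hΦ, hpΦ, hpk, h⟩
  · exact subset_closure h
  have hq : Φ p ∈ Φ.target := Φ.map_source hpΦ
  let e : Euc d := EuclideanSpace.single k (1 : ℝ)
  let c : ℝ → Euc d := fun t => Φ.symm (Φ p + t • e)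
  have hline : Tendsto (fun t : ℝ => Φ p + t • e) (𝓝[>] 0) (𝓝 (Φ p)) := by
    have : Continuous fun t : ℝ => Φ p + t • e := by fun_prop
    have := this.tendsto 0
    simp only [zero_smul, add_zero] at this
    exact this.mono_left nhdsWithin_le_nhds
  have hc : Tendsto c (𝓝[>] 0) (𝓝 p) := by
    have := (Φ.continuousAt_symm hq).tendsto.comp hline
    rwa [Φ.left_inv hpΦ] at this
  refine mem_closure_of_tendsto hc ?_
  filter_upwards [hline (Φ.open_target.mem_nhds hq), self_mem_nhdsWithin] with t ht htpos
  have hct : c t ∈ Φ.source := Φ.map_target ht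
  have hΦc : Φ (c t) = Φ p + t • e := Φ.right_inv ht
  have hcM : c t ∈ M := by
    refine (h _ hct).2 ⟨fun i hi => ?_, ?_⟩
    · have hik : i ≠ k := fun hik => by subst hik; omega
      simp [hΦc, e, ((h p hpΦ).1 hp).1 i hi, hik]
    · simpa [hΦc, e, hpk] using le_of_lt htpos
  -- Where the `k`-th coordinate is positive the half-space condition is vacuous, so the chart
  -- restricted there is an interior chart.
  have hopen : IsOpen {z : Euc d | 0 < z k} := isOpen_lt continuous_const (by fun_prop)
  have hopen' : IsOpen (Φ.source ∩ Φ ⁻¹' {z : Euc d | 0 < z k}) :=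
    Φ.isOpen_inter_preimage hopen
  refine ⟨hcM, Φ.restrOpen _ hopen', ⟨hΦ.1.mono fun x hx => ?_, hΦ.2.mono fun x hx => ?_⟩,
    ?_, ?_⟩
  · exact hx.1
  · exact hx.1
  · refine ⟨hct, hct, ?_⟩
    simpa [hΦc, e, hpk] using htpos
  · rintro x ⟨hx, -, hx0⟩
    exact (h x hx).trans (and_iff_left (le_of_lt hx0))

/-- Near a point of an `m`-dimensional submanifold, the orthogonal projection onto the tangent space
is almost an isometry. At an interior point it is open. -/
theorem IsCompactC2Submanifold.exists_tangent {d m : ℕ} {M : Set (Euc d)}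
    (hM : IsCompactC2Submanifold m M) {p : Euc d} (hp : p ∈ M) :
    ∃ T : Submodule ℝ (Euc d), Module.finrank ℝ T = m ∧
      (∀ η > 0, ∃ U ∈ 𝓝 p, ∀ x ∈ U ∩ M, ∀ y ∈ U ∩ M,
        (1 - η) * ‖x - y‖ ≤ ‖T.orthogonalProjectionOnto (x - y)‖) ∧
      (IsInteriorPt m M p → ∀ V ∈ 𝓝 p,
        T.orthogonalProjectionOnto '' (V ∩ M) ∈ 𝓝 (T.orthogonalProjectionOnto p)) := by
  -- The metric estimate needs only that the chart sends `M` into the coordinate subspace, so it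
  -- covers boundary points; openness needs the equivalence.
  have key : ∀ Φ : OpenPartialHomeomorph (Euc d) (Euc d), IsC2Diffeo Φ → p ∈ Φ.source →
      (∀ x ∈ Φ.source, x ∈ M → Φ x ∈ coordSubspace d m) →
      ∃ T : Submodule ℝ (Euc d), Module.finrank ℝ T = m ∧
      (∀ η > 0, ∃ U ∈ 𝓝 p, ∀ x ∈ U ∩ M, ∀ y ∈ U ∩ M,
        (1 - η) * ‖x - y‖ ≤ ‖T.orthogonalProjectionOnto (x - y)‖) ∧
      ((∀ x ∈ Φ.source, x ∈ M ↔ Φ x ∈ coordSubspace d m) → ∀ V ∈ 𝓝 p,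
        T.orthogonalProjectionOnto '' (V ∩ M) ∈ 𝓝 (T.orthogonalProjectionOnto p)) := by
    intro Φ hΦ hpΦ hflat
    obtain ⟨L, hL, hLs⟩ := hΦ.exists_deriv_equiv hpΦ
    refine ⟨(coordSubspace d m).map (L.symm.toLinearEquiv : Euc d →ₗ[ℝ] Euc d), ?_, ?_, ?_⟩
    · rw [LinearEquiv.finrank_map_eq, finrank_coordSubspace hM.dim_le]
    · intro η hη
      set T := (coordSubspace d m).map (L.symm.toLinearEquiv : Euc d →ₗ[ℝ] Euc d) with hT
      set K : ℝ := ‖(L.symm : Euc d →L[ℝ] Euc d)‖ + 1 with hK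
      have hKpos : 0 < K := by positivity
      -- Strict differentiability puts `x - y` within `η/2 * ‖x - y‖` of a vector `w` of `T`. This
      -- error is paid twice, once for `‖x - y‖` against `‖w‖` and once for `‖w‖` against the
      -- projection.
      have hc : 0 < η / (2 * K) := by positivity
      have hev := hL.isLittleO.def hc
      rw [nhds_prod_eq, eventually_prod_self_iff'] at hev
      obtain ⟨W, hW, hWs⟩ := hev
      refine ⟨W ∩ Φ.source, inter_mem hW (Φ.open_source.mem_nhds hpΦ), ?_⟩
      rintro x ⟨⟨hxW, hxs⟩, hxM⟩ y ⟨⟨hyW, hys⟩, hyM⟩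
      have h1 := hWs x hxW y hyW
      simp only at h1
      have hmem : L.symm (Φ x - Φ y) ∈ T :=
        Submodule.mem_map_of_mem (f := (L.symm.toLinearEquiv : Euc d →ₗ[ℝ] Euc d))
          (Submodule.sub_mem _ (hflat x hxs hxM) (hflat y hys hyM))
      set w := L.symm (Φ x - Φ y) with hw
      set e := (x - y) - w with he
      have hee : e = -L.symm (Φ x - Φ y - L (x - y)) := by
        rw [map_sub L.symm, L.symm_apply_apply, he, hw]; abel
      have hen : ‖e‖ ≤ η / 2 * ‖x - y‖ := by
        rw [hee, norm_neg]
        calc ‖L.symm (Φ x - Φ y - L (x - y))‖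
            ≤ ‖(L.symm : Euc d →L[ℝ] Euc d)‖ * ‖Φ x - Φ y - L (x - y)‖ :=
              (L.symm : Euc d →L[ℝ] Euc d).le_opNorm _
          _ ≤ K * (η / (2 * K) * ‖x - y‖) := by
              gcongr
              · linarith
              · exact h1
          _ = η / 2 * ‖x - y‖ := by field_simp
      have hproj : T.orthogonalProjectionOnto (x - y) = ⟨w, hmem⟩ + T.orthogonalProjectionOnto e := by
        have : x - y = w + e := by rw [he]; abel
        rw [this, map_add]
        congr 1
        exact Submodule.orthogonalProjectionOnto_mem_subspace_eq_self (⟨w, hmem⟩ : T)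
      have h2 : ‖T.orthogonalProjectionOnto e‖ ≤ ‖e‖ := T.norm_orthogonalProjectionOnto_apply_le e
      have h3 : ‖w‖ ≤ ‖T.orthogonalProjectionOnto (x - y)‖ + ‖T.orthogonalProjectionOnto e‖ := by
        have : (⟨w, hmem⟩ : T) = T.orthogonalProjectionOnto (x - y) - T.orthogonalProjectionOnto e := by
          rw [hproj]; abel
        calc ‖w‖ = ‖(⟨w, hmem⟩ : T)‖ := rfl
          _ ≤ _ := by rw [this]; exact norm_sub_le _ _
      have h4 : ‖x - y‖ ≤ ‖w‖ + ‖e‖ := by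
        have : x - y = w + e := by rw [he]; abel
        rw [this]; exact norm_add_le _ _
      linarith
    · intro hiff V hV
      set T := (coordSubspace d m).map (L.symm.toLinearEquiv : Euc d →ₗ[ℝ] Euc d) with hT
      let ι : coordSubspace d m →L[ℝ] Euc d := (coordSubspace d m).subtypeL
      -- The parametrization `ψ` of `M`, followed by the projection, has at `0` a derivative onto
      -- `T`, so it maps neighbourhoods to neighbourhoods.
      let ψ : coordSubspace d m → Euc d := fun u => Φ.symm (Φ p + ι u)
      have hq0 : Φ p + ι 0 = Φ p := by simp
      have hψ : HasStrictFDerivAt ψ ((L.symm : Euc d →L[ℝ] Euc d).comp ι) 0 := by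
        refine HasStrictFDerivAt.comp (g := Φ.symm) (f := fun u => Φ p + ι u) 0 ?_
          (ι.hasStrictFDerivAt.const_add (Φ p))
        rw [hq0]; exact hLs
      have hψ0 : ψ 0 = p := by simp only [ψ]; rw [hq0, Φ.left_inv hpΦ]
      have hF := T.orthogonalProjectionOnto.hasStrictFDerivAt.comp (0 : coordSubspace d m) hψ
      have hsurj : (T.orthogonalProjectionOnto.comp
          ((L.symm : Euc d →L[ℝ] Euc d).comp ι)).range = ⊤ := by
        refine LinearMap.range_eq_top.2 fun t => ?_
        obtain ⟨u, hu, hut⟩ := Submodule.mem_map.1 t.2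
        refine ⟨⟨u, hu⟩, ?_⟩
        have : (L.symm : Euc d →L[ℝ] Euc d) (ι ⟨u, hu⟩) = t := hut
        simp only [ContinuousLinearMap.coe_coe, ContinuousLinearMap.comp_apply]
        rw [this]
        exact Submodule.orthogonalProjectionOnto_mem_subspace_eq_self t
      have hmap := hF.map_nhds_eq_of_surj hsurj
      rw [hψ0] at hmap
      rw [← hmap]
      have hψc : Tendsto ψ (𝓝 0) (𝓝 p) := by
        have := hψ.continuousAt.tendsto
        rwa [hψ0] at this
      have hlin : Tendsto (fun u => Φ p + ι u) (𝓝 0) (𝓝 (Φ p)) := by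
        have : Continuous fun u => Φ p + ι u := by fun_prop
        simpa only [hq0] using this.tendsto 0
      rw [mem_map]
      filter_upwards [hψc hV, hlin (Φ.open_target.mem_nhds (Φ.map_source hpΦ))] with u hu hut
      refine ⟨ψ u, ⟨hu, (hiff _ (Φ.map_target hut)).2 ?_⟩, rfl⟩
      rw [Φ.right_inv hut]
      exact Submodule.add_mem _ (hflat p hpΦ hp) u.2
  by_cases hint : IsInteriorPt m M p
  · obtain ⟨-, Φ, hΦ, hpΦ, h⟩ := id hint
    obtain ⟨T, h1, h2, h3⟩ := key Φ hΦ hpΦ fun x hx hxM => (h x hx).1 hxM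
    exact ⟨T, h1, h2, fun _ => h3 h⟩
  · obtain ⟨Φ, hΦ, hpΦ, C, -, hC, hMC⟩ := hM.exists_convex_chart hp
    obtain ⟨T, h1, h2, -⟩ := key Φ hΦ hpΦ fun x hx hxM => hC ((hMC x hx).1 hxM)
    exact ⟨T, h1, h2, fun h => absurd h hint⟩

/-! ### The Gaussian kernel and its mass -/

/-- The Gaussian kernel on `ℝ^m`, as a function of the norm. -/
noncomputable def gaussianKernel (m : ℕ) (u : ℝ) : ℝ := Real.pi ^ (-(m : ℝ) / 2) * Real.exp (-u ^ 2)

theorem gaussianKernel_pos (m : ℕ) (u : ℝ) : 0 < gaussianKernel m u := by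
  unfold gaussianKernel; positivity

@[fun_prop]
theorem continuous_gaussianKernel (m : ℕ) : Continuous (gaussianKernel m) := by
  unfold gaussianKernel; fun_prop

theorem gaussianKernel_anti {m : ℕ} {u v : ℝ} (hu : 0 ≤ u) (huv : u ≤ v) :
    gaussianKernel m v ≤ gaussianKernel m u := by
  unfold gaussianKernel
  gcongr

theorem rpow_pi_le_one (m : ℕ) : Real.pi ^ (-(m : ℝ) / 2) ≤ 1 :=
  Real.rpow_le_one_of_one_le_of_nonpos (by linarith [Real.pi_gt_three])
    (by have : (0 : ℝ) ≤ m := m.cast_nonneg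
        linarith)

theorem gaussianKernel_le_one (m : ℕ) (u : ℝ) : gaussianKernel m u ≤ 1 := by
  unfold gaussianKernel
  exact mul_le_one₀ (rpow_pi_le_one m) (Real.exp_pos _).le
    (Real.exp_le_one_iff.2 (by nlinarith [sq_nonneg u]))

section Integral

variable {V : Type*} [NormedAddCommGroup V] [InnerProductSpace ℝ V] [FiniteDimensional ℝ V]
  [MeasurableSpace V] [BorelSpace V]

theorem lintegral_gaussianKernel {m : ℕ} (hV : Module.finrank ℝ V = m) {s : ℝ} (hs : 0 < s) :
    ∫⁻ z : V, ENNReal.ofReal (gaussianKernel m (‖z‖ / s)) = ENNReal.ofReal (s ^ m) := by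
  have hb : 0 < (s ^ 2)⁻¹ := by positivity
  have h1 := GaussianFourier.integral_rexp_neg_mul_sq_norm (V := V) hb
  have heq : ∀ z : V, gaussianKernel m (‖z‖ / s) =
      Real.pi ^ (-(m : ℝ) / 2) * Real.exp (-(s ^ 2)⁻¹ * ‖z‖ ^ 2) := fun z => by
    unfold gaussianKernel
    congr 2
    field_simp
  have hint : Integrable fun z : V => Real.exp (-(s ^ 2)⁻¹ * ‖z‖ ^ 2) := by
    refine Integrable.of_integral_ne_zero ?_
    rw [h1]; positivity
  simp_rw [heq]
  rw [← ofReal_integral_eq_lintegral_ofReal (hint.const_mul _)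
    (Eventually.of_forall fun z => by positivity), integral_const_mul, h1, hV]
  congr 1
  rw [div_inv_eq_mul, Real.mul_rpow Real.pi_pos.le (by positivity), ← mul_assoc,
    ← Real.rpow_add Real.pi_pos, ← Real.rpow_natCast s 2, ← Real.rpow_mul hs.le]
  rw [show -(m : ℝ) / 2 + m / 2 = 0 by ring, Real.rpow_zero, one_mul,
    show ((2 : ℕ) : ℝ) * (m / 2) = m by push_cast; ring, Real.rpow_natCast]

/-- Most of the mass of the scaled Gaussian kernel is on a fixed ball. -/
theorem le_lintegral_ball_gaussianKernel {m : ℕ} (hV : Module.finrank ℝ V = m) {s δ : ℝ}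
    (hs : 0 < s) (hδ : 0 ≤ δ) (c : V) :
    ENNReal.ofReal (s ^ m * (1 - √2 ^ m * Real.exp (-(δ ^ 2 / (2 * s ^ 2))))) ≤
      ∫⁻ z in Metric.ball c δ, ENNReal.ofReal (gaussianKernel m (‖c - z‖ / s)) := by
  have h2 : (0 : ℝ) < √2 := by positivity
  set g : V → ℝ≥0∞ := fun z => ENNReal.ofReal (gaussianKernel m (‖c - z‖ / s)) with hg
  have htot : ∫⁻ z, g z = ENNReal.ofReal (s ^ m) := by
    rw [← lintegral_gaussianKernel hV hs]
    exact lintegral_sub_left_eq_self (fun z : V => ENNReal.ofReal (gaussianKernel m (‖z‖ / s))) c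
  have htail : ∫⁻ z in (Metric.ball c δ)ᶜ, g z ≤
      ENNReal.ofReal (s ^ m * (√2 ^ m * Real.exp (-(δ ^ 2 / (2 * s ^ 2))))) := by
    -- Half of the exponent is bounded using the distance `δ`; the other half is a kernel of
    -- bandwidth `√2 * s`, whose mass gives the factor `√2 ^ m`.
    have hpt : ∀ z ∈ (Metric.ball c δ)ᶜ, g z ≤ ENNReal.ofReal (Real.exp (-(δ ^ 2 / (2 * s ^ 2)))) *
        ENNReal.ofReal (gaussianKernel m (‖c - z‖ / (√2 * s))) := by
      intro z hz
      have hz' : δ ≤ ‖c - z‖ := by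
        rw [mem_compl_iff, Metric.mem_ball', not_lt, dist_eq_norm] at hz
        exact hz
      rw [← ENNReal.ofReal_mul (by positivity)]
      refine ENNReal.ofReal_le_ofReal ?_
      unfold gaussianKernel
      rw [mul_left_comm, ← Real.exp_add]
      gcongr
      have h3 : (√2) ^ 2 = 2 := Real.sq_sqrt (by norm_num)
      have h4 : δ ^ 2 ≤ ‖c - z‖ ^ 2 := by gcongr
      rw [div_pow, div_pow, mul_pow, h3]
      have h5 : δ ^ 2 / (2 * s ^ 2) ≤ ‖c - z‖ ^ 2 / (2 * s ^ 2) := by gcongr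
      have h6 : ‖c - z‖ ^ 2 / s ^ 2 = 2 * (‖c - z‖ ^ 2 / (2 * s ^ 2)) := by field_simp
      linarith
    calc ∫⁻ z in (Metric.ball c δ)ᶜ, g z
        ≤ ∫⁻ z in (Metric.ball c δ)ᶜ, ENNReal.ofReal (Real.exp (-(δ ^ 2 / (2 * s ^ 2)))) *
          ENNReal.ofReal (gaussianKernel m (‖c - z‖ / (√2 * s))) :=
          setLIntegral_mono (by fun_prop) hpt
      _ ≤ ∫⁻ z, ENNReal.ofReal (Real.exp (-(δ ^ 2 / (2 * s ^ 2)))) *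
          ENNReal.ofReal (gaussianKernel m (‖c - z‖ / (√2 * s))) := setLIntegral_le_lintegral _ _
      _ = ENNReal.ofReal (Real.exp (-(δ ^ 2 / (2 * s ^ 2)))) *
          ENNReal.ofReal ((√2 * s) ^ m) := by
          rw [lintegral_const_mul _ (by fun_prop), ← lintegral_gaussianKernel hV
            (show 0 < √2 * s by positivity)]
          congr 1
          exact lintegral_sub_left_eq_self
            (fun z : V => ENNReal.ofReal (gaussianKernel m (‖z‖ / (√2 * s)))) c
      _ = _ := by
          rw [← ENNReal.ofReal_mul (by positivity), mul_pow]
          congr 1; ring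
  have hsplit := lintegral_add_compl g (Metric.isOpen_ball (x := c) (ε := δ)).measurableSet (μ := volume)
  rw [htot] at hsplit
  rw [mul_sub, mul_one, ENNReal.ofReal_sub _ (by positivity), ← hsplit]
  exact tsub_le_iff_right.2 (by gcongr)

end Integral

/-! ### Hausdorff measure under Lipschitz maps -/

section HausdorffMeasure

variable {X Y : Type*} [EMetricSpace X] [MeasurableSpace X] [BorelSpace X]
  [EMetricSpace Y] [MeasurableSpace Y] [BorelSpace Y]

theorem _root_.LipschitzOnWith.euclideanHausdorffMeasure_image_le {K : NNReal} {P : X → Y}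
    {S : Set X} (hP : LipschitzOnWith K P S) (m : ℕ) :
    (Measure.euclideanHausdorffMeasure m : Measure Y) (P '' S) ≤
      (K : ℝ≥0∞) ^ m * (Measure.euclideanHausdorffMeasure m : Measure X) S := by
  have h := hP.hausdorffMeasure_image_le (d := m) (by positivity)
  simp only [Measure.euclideanHausdorffMeasure_def, Measure.smul_apply, ENNReal.smul_def,
    smul_eq_mul]
  rw [ENNReal.rpow_natCast] at h
  rw [mul_left_comm]
  gcongr

/-- The hypothesis makes `P` injective on `S` with a `K`-Lipschitz inverse, to which the Lipschitz
bound is applied. It serves the upper bound of the smoothed density. -/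
theorem map_restrict_euclideanHausdorffMeasure_le {K : NNReal} {P : X → Y} (hP : Measurable P)
    {S : Set X} (hK : ∀ x ∈ S, ∀ y ∈ S, edist x y ≤ K * edist (P x) (P y)) (m : ℕ) :
    ((Measure.euclideanHausdorffMeasure m : Measure X).restrict S).map P ≤
      (K : ℝ≥0∞) ^ m • (Measure.euclideanHausdorffMeasure m : Measure Y) := by
  refine Measure.le_iff.2 fun B hB => ?_
  rw [Measure.map_apply hP hB, Measure.restrict_apply (hP hB), Measure.smul_apply, smul_eq_mul]
  rcases S.eq_empty_or_nonempty with rfl | ⟨x₀, -⟩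
  · simp
  have : Nonempty X := ⟨x₀⟩
  have hinj : InjOn P S := fun x hx y hy hxy => by
    have := hK x hx y hy
    rw [hxy, edist_self, mul_zero] at this
    exact edist_le_zero.1 this
  have hlip : LipschitzOnWith K (Function.invFunOn P S) (P '' (P ⁻¹' B ∩ S)) := by
    rintro _ ⟨x, hx, rfl⟩ _ ⟨y, hy, rfl⟩
    rw [hinj.leftInvOn_invFunOn hx.2, hinj.leftInvOn_invFunOn hy.2]
    exact hK x hx.2 y hy.2
  have himg : Function.invFunOn P S '' (P '' (P ⁻¹' B ∩ S)) = P ⁻¹' B ∩ S := by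
    rw [image_image]
    exact (image_congr fun x hx => hinj.leftInvOn_invFunOn hx.2).trans (image_id _)
  calc _ = (Measure.euclideanHausdorffMeasure m : Measure X)
        (Function.invFunOn P S '' (P '' (P ⁻¹' B ∩ S))) := by rw [himg]
    _ ≤ (K : ℝ≥0∞) ^ m * (Measure.euclideanHausdorffMeasure m : Measure Y)
        (P '' (P ⁻¹' B ∩ S)) := hlip.euclideanHausdorffMeasure_image_le m
    _ ≤ _ := by
      gcongr
      exact (image_mono inter_subset_left).trans (image_preimage_subset P B)

/-- Each part of `A` is covered by the image of a part of `S`, and a contraction does not increase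
the measure. It serves the lower bound of the smoothed density. -/
theorem restrict_euclideanHausdorffMeasure_le_map {P : X → Y} (hP : LipschitzWith 1 P)
    {S : Set X} {A : Set Y} (hA : A ⊆ P '' S) (m : ℕ) :
    (Measure.euclideanHausdorffMeasure m : Measure Y).restrict A ≤
      ((Measure.euclideanHausdorffMeasure m : Measure X).restrict S).map P := by
  refine Measure.le_iff.2 fun B hB => ?_
  have hPm := hP.continuous.measurable
  rw [Measure.map_apply hPm hB, Measure.restrict_apply (hPm hB), Measure.restrict_apply hB]
  have hsub : B ∩ A ⊆ P '' (P ⁻¹' B ∩ S) := by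
    rintro z ⟨hzB, hzA⟩
    obtain ⟨x, hx, rfl⟩ := hA hzA
    exact ⟨x, ⟨hzB, hx⟩, rfl⟩
  refine (measure_mono hsub).trans ?_
  simpa using (hP.lipschitzOnWith (s := P ⁻¹' B ∩ S)).euclideanHausdorffMeasure_image_le m

end HausdorffMeasure

/-! ### The smoothed density: bias bounds -/

theorem setLIntegral_densityLaw {d m : ℕ} {M : Set (Euc d)} (hM : MeasurableSet M)
    {f : Euc d → ℝ} (hf : ContinuousOn f M) {A : Set (Euc d)} (hA : MeasurableSet A)
    {g : Euc d → ℝ≥0∞} (hg : Measurable g) :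
    ∫⁻ y in A, g y ∂densityLaw m M f =
      ∫⁻ y in A ∩ M, ENNReal.ofReal (f y) * g y ∂(Measure.euclideanHausdorffMeasure m) := by
  unfold densityLaw
  have hfm : AEMeasurable (fun x => ENNReal.ofReal (f x))
      ((Measure.euclideanHausdorffMeasure m : Measure (Euc d)).restrict M) :=
    (hf.aemeasurable hM).ennreal_ofReal
  rw [restrict_withDensity hA, Measure.restrict_restrict hA, lintegral_withDensity_eq_lintegral_mul₀]
  · rfl
  · rw [← Measure.restrict_restrict hA]; exact hfm.restrict
  · exact hg.aemeasurable

/-- The convolution of the measure `μ` with the Gaussian kernel of bandwidth `h`. -/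
noncomputable def smoothed {d : ℕ} (μ : Measure (Euc d)) (m : ℕ) (h : ℝ) (x : Euc d) : ℝ :=
  (h ^ m)⁻¹ * ∫ y, gaussianKernel m (‖x - y‖ / h) ∂μ

theorem smoothed_nonneg {d : ℕ} (μ : Measure (Euc d)) (m : ℕ) {h : ℝ} (hh : 0 < h) (x : Euc d) :
    0 ≤ smoothed μ m h x :=
  mul_nonneg (by positivity) (integral_nonneg fun y => (gaussianKernel_pos m _).le)

theorem integrable_gaussianKernel {d : ℕ} {μ : Measure (Euc d)} [IsFiniteMeasure μ] (m : ℕ) (h : ℝ)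
    (x : Euc d) : Integrable (fun y => gaussianKernel m (‖x - y‖ / h)) μ := by
  refine Integrable.of_bound (Continuous.aestronglyMeasurable (by fun_prop)) 1
    (Eventually.of_forall fun y => ?_)
  rw [Real.norm_of_nonneg (gaussianKernel_pos m _).le]
  exact gaussianKernel_le_one m _

theorem ofReal_smoothed {d : ℕ} {μ : Measure (Euc d)} [IsFiniteMeasure μ] (m : ℕ) {h : ℝ}
    (hh : 0 < h) (x : Euc d) : ENNReal.ofReal (h ^ m * smoothed μ m h x) =
      ∫⁻ y, ENNReal.ofReal (gaussianKernel m (‖x - y‖ / h)) ∂μ := by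
  have : h ^ m ≠ 0 := by positivity
  rw [smoothed, mul_inv_cancel_left₀ this, ofReal_integral_eq_lintegral_ofReal
    (integrable_gaussianKernel m h x) (Eventually.of_forall fun y => (gaussianKernel_pos m _).le)]

/-- Gaussian decay beats the power of `h`. The expression bounds the contribution to the smoothed
density of the mass at distance at least `δ`. -/
theorem tendsto_inv_pow_mul_gaussianKernel (m : ℕ) {δ : ℝ} (hδ : 0 < δ) :
    Tendsto (fun h : ℝ => (h ^ m)⁻¹ * gaussianKernel m (δ / h)) (𝓝[>] 0) (𝓝 0) := by
  have h1 : Tendsto (fun x : ℝ => |x| ^ (m : ℝ) * Real.exp (-δ ^ 2 * x ^ 2)) atTop (𝓝 0) :=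
    (tendsto_rpow_abs_mul_exp_neg_mul_sq_cocompact (show 0 < δ ^ 2 by positivity) m).mono_left
      atTop_le_cocompact
  have h2 := (h1.comp tendsto_inv_nhdsGT_zero).const_mul (Real.pi ^ (-(m : ℝ) / 2))
  rw [mul_zero] at h2
  refine h2.congr' ?_
  filter_upwards [self_mem_nhdsWithin] with h hh
  have hh' : 0 < h := hh
  simp only [Function.comp_apply, gaussianKernel, Real.rpow_natCast]
  rw [abs_of_pos (inv_pos.2 hh'), inv_pow, mul_left_comm, show -δ ^ 2 * h⁻¹ ^ 2 = -(δ / h) ^ 2 by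
    rw [div_eq_mul_inv]; ring]

/-- Near each point of `M`, the smoothed density is asymptotically at most the density. -/
theorem eventually_smoothed_le {d m : ℕ} {M : Set (Euc d)} (hM : IsCompactC2Submanifold m M)
    {f : Euc d → ℝ} (hf : ContinuousOn f M) (hf0 : ∀ x ∈ M, 0 ≤ f x)
    [IsProbabilityMeasure (densityLaw m M f)] {p : Euc d} (hp : p ∈ M) {ε : ℝ} (hε : 0 < ε) :
    ∃ U ∈ 𝓝 p, ∀ᶠ h in 𝓝[>] (0 : ℝ), ∀ x ∈ U ∩ M, smoothed (densityLaw m M f) m h x ≤ f p + ε := by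
  have hMm : MeasurableSet M := hM.isCompact.isClosed.measurableSet
  -- A single `t` bounds both the oscillation of `f` near `p` and the distortion of the projection;
  -- the other `ε / 2` is for the far mass.
  obtain ⟨t, ht0, ht1, ht⟩ : ∃ t : ℝ, 0 < t ∧ t < 1 ∧ (f p + t) * ((1 - t)⁻¹) ^ m < f p + ε / 2 := by
    have hc : ContinuousAt (fun t : ℝ => (f p + t) * ((1 - t)⁻¹) ^ m) 0 := by
      have : ContinuousAt (fun t : ℝ => (1 - t)⁻¹) 0 :=
        ContinuousAt.inv₀ (by fun_prop) (by norm_num)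
      fun_prop
    have h1 : ∀ᶠ t in 𝓝 (0 : ℝ), (f p + t) * ((1 - t)⁻¹) ^ m < f p + ε / 2 :=
      hc.eventually_lt_const (by simp; linarith)
    have h2 : ∀ᶠ t in 𝓝[>] (0 : ℝ), t ∈ Ioo (0 : ℝ) 1 := Ioo_mem_nhdsGT one_pos
    obtain ⟨t, h3, h4⟩ := ((h1.filter_mono nhdsWithin_le_nhds).and h2).exists
    exact ⟨t, h4.1, h4.2, h3⟩
  obtain ⟨T, hT, hTη, -⟩ := hM.exists_tangent hp
  obtain ⟨U, hU, hUT⟩ := hTη t ht0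
  have hfU : ∀ᶠ x in 𝓝[M] p, f x < f p + t := (hf p hp).eventually_lt_const (by linarith)
  rw [eventually_nhdsWithin_iff] at hfU
  obtain ⟨δ₂, hδ₂, hball⟩ := Metric.mem_nhds_iff.1 (inter_mem hU hfU)
  obtain ⟨δ, hδ, rfl⟩ : ∃ δ > 0, δ₂ = 2 * δ := ⟨δ₂ / 2, by positivity, by ring⟩
  refine ⟨Metric.ball p δ, Metric.ball_mem_nhds _ hδ, ?_⟩
  filter_upwards [self_mem_nhdsWithin,
    (tendsto_inv_pow_mul_gaussianKernel m hδ).eventually_lt_const (show 0 < ε / 2 by positivity)]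
    with h hh hhε x hx
  have hh : 0 < h := hh
  set μ := densityLaw m M f
  set B := Metric.ball p (2 * δ)
  have hBm : MeasurableSet B := Metric.isOpen_ball.measurableSet
  set P := T.orthogonalProjectionOnto with hP
  set k : ℝ → ℝ≥0∞ := fun u => ENNReal.ofReal (gaussianKernel m (u / h)) with hk
  have hkm : Measurable k := by fun_prop
  have hkanti : ∀ u v, 0 ≤ u → u ≤ v → k v ≤ k u := fun u v hu huv =>
    ENNReal.ofReal_le_ofReal (gaussianKernel_anti (by positivity) (by gcongr))
  have hxB : x ∈ B := Metric.ball_subset_ball (by linarith) hx.1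
  have hfar : ∫⁻ y in Bᶜ, k ‖x - y‖ ∂μ ≤ ENNReal.ofReal (gaussianKernel m (δ / h)) := by
    calc ∫⁻ y in Bᶜ, k ‖x - y‖ ∂μ ≤ ∫⁻ y in Bᶜ, k δ ∂μ := by
          refine setLIntegral_mono measurable_const fun y hy => hkanti _ _ hδ.le ?_
          rw [← dist_eq_norm]
          have h1 : 2 * δ ≤ dist y p := not_lt.1 hy
          have h2 : dist x p < δ := hx.1
          linarith [dist_triangle_left y p x]
      _ ≤ k δ * 1 := by
          rw [setLIntegral_const]; gcongr; exact prob_le_one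
      _ = _ := mul_one _
  have hnear : ∫⁻ y in B, k ‖x - y‖ ∂μ ≤
      ENNReal.ofReal ((f p + t) * ((1 - t)⁻¹) ^ m * h ^ m) := by
    have hfp := hf0 p hp
    calc ∫⁻ y in B, k ‖x - y‖ ∂μ = ∫⁻ y in B ∩ M, ENNReal.ofReal (f y) * k ‖x - y‖
          ∂(Measure.euclideanHausdorffMeasure m) :=
          setLIntegral_densityLaw hMm hf hBm (by fun_prop)
      _ ≤ ∫⁻ y in B ∩ M, ENNReal.ofReal (f p + t) * k ‖P x - P y‖
          ∂(Measure.euclideanHausdorffMeasure m) := by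
          refine setLIntegral_mono (by fun_prop) fun y hy => ?_
          have h1 : f y ≤ f p + t := ((hball hy.1).2 hy.2).le
          -- The projection shortens distances and the kernel is decreasing, so projecting can only
          -- increase it.
          refine mul_le_mul' (ENNReal.ofReal_le_ofReal h1) (hkanti _ _ (norm_nonneg _) ?_)
          rw [← map_sub]
          exact T.norm_orthogonalProjectionOnto_apply_le _
      _ = ENNReal.ofReal (f p + t) * ∫⁻ z, k ‖P x - z‖
          ∂(((Measure.euclideanHausdorffMeasure m).restrict (B ∩ M)).map P) := by
          rw [lintegral_const_mul _ (by fun_prop), lintegral_map (by fun_prop) (by fun_prop)]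
      _ ≤ ENNReal.ofReal (f p + t) * ∫⁻ z, k ‖P x - z‖
          ∂((((1 - t)⁻¹.toNNReal : NNReal) : ℝ≥0∞) ^ m •
            (Measure.euclideanHausdorffMeasure m : Measure T)) := by
          gcongr
          refine map_restrict_euclideanHausdorffMeasure_le (by fun_prop) (fun y hy z hz => ?_) m
          have h1 := hUT y ⟨(hball hy.1).1, hy.2⟩ z ⟨(hball hz.1).1, hz.2⟩
          rw [edist_dist, edist_dist, ← ENNReal.ofReal, ← ENNReal.ofReal_mul (by
            have : 0 < 1 - t := by linarith
            positivity)]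
          refine ENNReal.ofReal_le_ofReal ?_
          rw [dist_eq_norm, dist_eq_norm, ← map_sub, le_inv_mul_iff₀ (by linarith)]
          exact h1
      _ = ENNReal.ofReal (f p + t) * (ENNReal.ofReal (1 - t)⁻¹ ^ m * ENNReal.ofReal (h ^ m)) := by
          have hvol : (Measure.euclideanHausdorffMeasure m : Measure T) = volume := by
            subst hT
            exact InnerProductSpace.euclideanHausdorffMeasure_eq_volume
          rw [lintegral_smul_measure, ← lintegral_gaussianKernel hT hh, hvol,
            lintegral_sub_left_eq_self (μ := volume) (fun z : T => k ‖z‖) (P x)]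
          rfl
      _ = _ := by
          have : 0 < 1 - t := by linarith
          rw [← ENNReal.ofReal_pow (by positivity), ← ENNReal.ofReal_mul (by positivity),
            ← ENNReal.ofReal_mul (by positivity), mul_assoc]
  have htot : h ^ m * smoothed μ m h x ≤
      (f p + t) * ((1 - t)⁻¹) ^ m * h ^ m + gaussianKernel m (δ / h) := by
    have hfp := hf0 p hp
    have : 0 < 1 - t := by linarith
    have hk0 := gaussianKernel_pos m (δ / h)
    rw [← ENNReal.ofReal_le_ofReal_iff (by positivity), ofReal_smoothed m hh x,
      ENNReal.ofReal_add (by positivity) hk0.le, ← lintegral_add_compl _ hBm]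
    exact add_le_add hnear hfar
  have hhm : 0 < h ^ m := by positivity
  have hgoal : smoothed μ m h x ≤
      (f p + t) * ((1 - t)⁻¹) ^ m + (h ^ m)⁻¹ * gaussianKernel m (δ / h) := by
    rw [← mul_le_mul_iff_right₀ hhm, mul_add, mul_inv_cancel_left₀ hhm.ne']
    linarith
  linarith

theorem tendsto_gaussian_mass (m : ℕ) {δ : ℝ} (hδ : 0 < δ) :
    Tendsto (fun s : ℝ => 1 - √2 ^ m * Real.exp (-(δ ^ 2 / (2 * s ^ 2)))) (𝓝[>] 0) (𝓝 1) := by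
  have h1 : Tendsto (fun s : ℝ => (δ ^ 2 / 2) * (s⁻¹) ^ 2) (𝓝[>] 0) atTop :=
    ((tendsto_pow_atTop two_ne_zero).comp tendsto_inv_nhdsGT_zero).const_mul_atTop (by positivity)
  have h2 := (Real.tendsto_exp_neg_atTop_nhds_zero.comp h1).const_mul (√2 ^ m)
  have h3 := h2.const_sub 1
  rw [mul_zero, sub_zero] at h3
  refine h3.congr fun s => ?_
  simp only [Function.comp_apply]
  congr 4
  rw [inv_pow, div_mul_eq_div_div, div_eq_mul_inv _ (s ^ 2)]

/-- Near each interior point of `M`, the smoothed density is asymptotically at least the density. -/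
theorem eventually_le_smoothed {d m : ℕ} {M : Set (Euc d)} (hM : IsCompactC2Submanifold m M)
    {f : Euc d → ℝ} (hf : ContinuousOn f M) [IsProbabilityMeasure (densityLaw m M f)]
    {p : Euc d} (hp : IsInteriorPt m M p) (hfp : 0 < f p) {ε : ℝ} (hε : 0 < ε) :
    ∃ U ∈ 𝓝 p, ∀ᶠ h in 𝓝[>] (0 : ℝ), ∀ x ∈ U ∩ M, f p - ε ≤ smoothed (densityLaw m M f) m h x := by
  have hMm : MeasurableSet M := hM.isCompact.isClosed.measurableSet
  obtain ⟨t, ht0, ht1, htf, ht⟩ : ∃ t : ℝ, 0 < t ∧ t < 1 ∧ t < f p ∧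
      f p - ε < (f p - t) * (1 - t) ^ m := by
    have hc : ContinuousAt (fun t : ℝ => (f p - t) * (1 - t) ^ m) 0 := by fun_prop
    have h1 : ∀ᶠ t in 𝓝 (0 : ℝ), f p - ε < (f p - t) * (1 - t) ^ m :=
      hc.eventually_const_lt (by simp; linarith)
    have h2 : ∀ᶠ t in 𝓝[>] (0 : ℝ), t ∈ Ioo (0 : ℝ) (min 1 (f p)) :=
      Ioo_mem_nhdsGT (lt_min one_pos hfp)
    obtain ⟨t, h3, h4⟩ := ((h1.filter_mono nhdsWithin_le_nhds).and h2).exists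
    exact ⟨t, h4.1, h4.2.trans_le (min_le_left _ _), h4.2.trans_le (min_le_right _ _), h3⟩
  have h1t : 0 < 1 - t := by linarith
  obtain ⟨T, hT, hTη, hTopen⟩ := hM.exists_tangent hp.1
  obtain ⟨U, hU, hUT⟩ := hTη t ht0
  have hfU : ∀ᶠ x in 𝓝[M] p, f p - t < f x := (hf p hp.1).eventually_const_lt (by linarith)
  rw [eventually_nhdsWithin_iff] at hfU
  obtain ⟨B, hB, hBo, hpB⟩ := mem_nhds_iff.1 (inter_mem hU hfU)
  have hBm : MeasurableSet B := hBo.measurableSet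
  set P := T.orthogonalProjectionOnto with hP
  have hPlip : LipschitzWith 1 P := LipschitzWith.of_dist_le_mul fun y z => by
    rw [dist_eq_norm, dist_eq_norm, ← map_sub, NNReal.coe_one, one_mul]
    exact T.norm_orthogonalProjectionOnto_apply_le _
  -- Interiority enters here: the projection of `M` near `p` covers a full ball of the tangent
  -- space, which carries almost all of the kernel mass.
  obtain ⟨δ₂, hδ₂, hball⟩ := Metric.mem_nhds_iff.1 (hTopen hp B (hBo.mem_nhds hpB))
  obtain ⟨δ, hδ, rfl⟩ : ∃ δ > 0, δ₂ = 2 * δ := ⟨δ₂ / 2, by positivity, by ring⟩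
  refine ⟨B ∩ Metric.ball p δ, inter_mem (hBo.mem_nhds hpB) (Metric.ball_mem_nhds _ hδ), ?_⟩
  -- As `(1 - t) * ‖x - y‖ ≤ ‖P x - P y‖`, the kernel of bandwidth `h` at `‖x - y‖` is at least the
  -- kernel of the reduced bandwidth `(1 - t) * h` at the projected distance.
  have hs : Tendsto (fun h : ℝ => (1 - t) * h) (𝓝[>] 0) (𝓝[>] 0) := by
    refine tendsto_nhdsWithin_iff.2 ⟨?_, ?_⟩
    · have : Continuous fun h : ℝ => (1 - t) * h := by fun_prop
      have := this.tendsto 0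
      rw [mul_zero] at this
      exact this.mono_left nhdsWithin_le_nhds
    · filter_upwards [self_mem_nhdsWithin] with h hh
      exact mul_pos h1t hh
  have hlim := ((tendsto_gaussian_mass m hδ).comp hs).const_mul ((f p - t) * (1 - t) ^ m)
  rw [mul_one] at hlim
  filter_upwards [self_mem_nhdsWithin, hlim.eventually_const_lt ht] with h hh hhε x hx
  have hh : 0 < h := hh
  simp only [Function.comp_apply] at hhε
  refine hhε.le.trans ?_
  set μ := densityLaw m M f
  set s := (1 - t) * h with hsdef
  have hspos : 0 < s := by positivity
  set k : ℝ → ℝ≥0∞ := fun u => ENNReal.ofReal (gaussianKernel m (u / h)) with hk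
  set k' : ℝ → ℝ≥0∞ := fun u => ENNReal.ofReal (gaussianKernel m (u / s)) with hk'
  set w := 1 - √2 ^ m * Real.exp (-(δ ^ 2 / (2 * s ^ 2))) with hw
  have hballx : Metric.ball (P x) δ ⊆ P '' (B ∩ M) := by
    refine Subset.trans (fun z hz => ?_) hball
    have h1 := hPlip.dist_le_mul x p
    rw [NNReal.coe_one, one_mul] at h1
    have h2 : dist x p < δ := hx.1.2
    have h3 : dist z (P x) < δ := hz
    exact Metric.mem_ball.2 (by linarith [dist_triangle z (P x) (P p)])
  have hlow : ENNReal.ofReal ((f p - t) * (s ^ m * w)) ≤ ∫⁻ y, k ‖x - y‖ ∂μ := by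
    calc ENNReal.ofReal ((f p - t) * (s ^ m * w))
        = ENNReal.ofReal (f p - t) * ENNReal.ofReal (s ^ m * w) :=
          ENNReal.ofReal_mul (by linarith)
      _ ≤ ENNReal.ofReal (f p - t) * ∫⁻ z in Metric.ball (P x) δ, k' ‖P x - z‖ := by
          gcongr
          exact le_lintegral_ball_gaussianKernel hT hspos hδ.le (P x)
      _ ≤ ENNReal.ofReal (f p - t) * ∫⁻ z, k' ‖P x - z‖
          ∂(((Measure.euclideanHausdorffMeasure m).restrict (B ∩ M)).map P) := by
          gcongr
          have := restrict_euclideanHausdorffMeasure_le_map hPlip hballx m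
          subst hT
          rwa [InnerProductSpace.euclideanHausdorffMeasure_eq_volume] at this
      _ = ∫⁻ y in B ∩ M, ENNReal.ofReal (f p - t) * k' ‖P x - P y‖
          ∂(Measure.euclideanHausdorffMeasure m) := by
          rw [lintegral_const_mul _ (by fun_prop), lintegral_map (by fun_prop) (by fun_prop)]
      _ ≤ ∫⁻ y in B ∩ M, ENNReal.ofReal (f y) * k ‖x - y‖
          ∂(Measure.euclideanHausdorffMeasure m) := by
          refine setLIntegral_mono_ae' (hBm.inter hMm) (Eventually.of_forall fun y hy => ?_)
          have h1 : f p - t ≤ f y := ((hB hy.1).2 hy.2).le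
          refine mul_le_mul' (ENNReal.ofReal_le_ofReal h1) (ENNReal.ofReal_le_ofReal
            (gaussianKernel_anti (by positivity) ?_))
          have h2 := hUT x ⟨(hB hx.1.1).1, hx.2⟩ y ⟨(hB hy.1).1, hy.2⟩
          rw [← map_sub, div_le_div_iff₀ hh hspos, hsdef]
          calc ‖x - y‖ * ((1 - t) * h) = ((1 - t) * ‖x - y‖) * h := by ring
            _ ≤ _ := by gcongr
      _ = ∫⁻ y in B, k ‖x - y‖ ∂μ := (setLIntegral_densityLaw hMm hf hBm (by fun_prop)).symm
      _ ≤ _ := setLIntegral_le_lintegral _ _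
  have hhm : 0 < h ^ m := by positivity
  have hsm := smoothed_nonneg μ m hh x
  rw [hk, ← ofReal_smoothed m hh x, ENNReal.ofReal_le_ofReal_iff (by positivity)] at hlow
  rw [← mul_le_mul_iff_right₀ hhm]
  refine le_trans (le_of_eq ?_) hlow
  rw [hsdef, mul_pow]; ring

/-! ### Exponential bounds for independent samples -/

section Chernoff

variable {Ω E : Type*} [MeasurableSpace Ω] {P : Measure Ω}
  [MeasurableSpace E] {μ : Measure E} [IsProbabilityMeasure μ]

/-- A bound for the moment generating function of a random variable with values in `[0, 1]`. -/
theorem mgf_comp_le {Y : Ω → E} (hY : HasLaw Y μ P) {φ : E → ℝ} (hφ : Measurable φ)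
    (hφ0 : ∀ y, 0 ≤ φ y) (hφ1 : ∀ y, φ y ≤ 1) {θ : ℝ} (hθ : |θ| ≤ 1) :
    mgf (φ ∘ Y) P θ ≤ Real.exp ((θ + θ ^ 2) * ∫ y, φ y ∂μ) := by
  have hint : Integrable φ μ := Integrable.of_bound hφ.aestronglyMeasurable 1
    (Eventually.of_forall fun y => by rw [Real.norm_of_nonneg (hφ0 y)]; exact hφ1 y)
  have h1 : mgf (φ ∘ Y) P θ = ∫ y, Real.exp (θ * φ y) ∂μ :=
    hY.integral_comp (f := fun y => Real.exp (θ * φ y)) (by fun_prop)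
  -- From `exp x ≤ 1 + x + x²` for `|x| ≤ 1` and `φ² ≤ φ`: the second moment is controlled by the
  -- mean, which for the kernel is of order `h^m`.
  have h2 : ∫ y, Real.exp (θ * φ y) ∂μ ≤ ∫ y, (1 + (θ + θ ^ 2) * φ y) ∂μ := by
    refine integral_mono_of_nonneg (Eventually.of_forall fun y => (Real.exp_pos _).le)
      ((integrable_const _).add (hint.const_mul _)) (Eventually.of_forall fun y => ?_)
    have h3 : |θ * φ y| ≤ 1 := by
      rw [abs_mul, abs_of_nonneg (hφ0 y)]
      exact mul_le_one₀ hθ (hφ0 y) (hφ1 y)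
    have h4 := (abs_le.1 (Real.abs_exp_sub_one_sub_id_le h3)).2
    have h5 : φ y ^ 2 ≤ φ y := by nlinarith [hφ0 y, hφ1 y]
    have h6 : θ ^ 2 * φ y ^ 2 ≤ θ ^ 2 * φ y := by gcongr
    simp only
    nlinarith
  rw [integral_add (integrable_const _) (hint.const_mul _), integral_const_mul] at h2
  simp only [integral_const, probReal_univ, smul_eq_mul, mul_one] at h2
  rw [h1]
  exact h2.trans (by linarith [Real.add_one_le_exp ((θ + θ ^ 2) * ∫ y, φ y ∂μ)])

variable {X : ℕ → Ω → E}

theorem mgf_sum_comp_le (hX : ∀ i, HasLaw (X i) μ P) (hindep : iIndepFun X P) {φ : E → ℝ}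
    (hφ : Measurable φ) (hφ0 : ∀ y, 0 ≤ φ y) (hφ1 : ∀ y, φ y ≤ 1) {θ : ℝ} (hθ : |θ| ≤ 1) (n : ℕ) :
    mgf (∑ i ∈ Finset.range n, φ ∘ X i) P θ ≤
      Real.exp (n * ((θ + θ ^ 2) * ∫ y, φ y ∂μ)) := by
  rw [(hindep.comp (fun _ => φ) fun _ => hφ).mgf_sum₀
    fun i => hφ.comp_aemeasurable (hX i).aemeasurable]
  calc ∏ i ∈ Finset.range n, mgf (φ ∘ X i) P θ
      ≤ ∏ i ∈ Finset.range n, Real.exp ((θ + θ ^ 2) * ∫ y, φ y ∂μ) :=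
        Finset.prod_le_prod (fun i _ => mgf_nonneg)
          fun i _ => mgf_comp_le (hX i) hφ hφ0 hφ1 hθ
    _ = _ := by rw [Finset.prod_const, Finset.card_range, ← Real.exp_nat_mul]

/-- A Bernstein type bound for the deviation of a sum of independent variables from its mean. -/
theorem measureReal_abs_sum_sub_ge_le [IsProbabilityMeasure P] (hX : ∀ i, HasLaw (X i) μ P) (hindep : iIndepFun X P)
    {φ : E → ℝ} (hφ : Measurable φ) (hφ0 : ∀ y, 0 ≤ φ y) (hφ1 : ∀ y, φ y ≤ 1) {θ : ℝ} (hθ0 : 0 ≤ θ)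
    (hθ1 : θ ≤ 1) (n : ℕ) (b : ℝ) :
    P.real {ω | n * b ≤ |∑ i ∈ Finset.range n, φ (X i ω) - n * ∫ y, φ y ∂μ|} ≤
      2 * Real.exp (-(n * (θ * b - θ ^ 2 * ∫ y, φ y ∂μ))) := by
  set a := ∫ y, φ y ∂μ
  set S : Ω → ℝ := ∑ i ∈ Finset.range n, φ ∘ X i with hS
  have hSω : ∀ ω, S ω = ∑ i ∈ Finset.range n, φ (X i ω) := fun ω => by simp [hS]
  have hSm : AEMeasurable S P := by
    rw [hS]
    exact Finset.aemeasurable_sum _ fun i _ => hφ.comp_aemeasurable (hX i).aemeasurable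
  have hint : ∀ t : ℝ, Integrable (fun ω => Real.exp (t * S ω)) P := fun t => by
    refine Integrable.of_bound (by fun_prop) (Real.exp (|t| * n)) (Eventually.of_forall fun ω => ?_)
    rw [Real.norm_of_nonneg (Real.exp_pos _).le, Real.exp_le_exp]
    have h0 : 0 ≤ S ω := by rw [hSω]; exact Finset.sum_nonneg fun i _ => hφ0 _
    have h1 : S ω ≤ n := by
      rw [hSω]
      calc _ ≤ ∑ i ∈ Finset.range n, (1 : ℝ) := Finset.sum_le_sum fun i _ => hφ1 _
        _ = n := by simp
    calc t * S ω ≤ |t| * S ω := by gcongr; exact le_abs_self t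
      _ ≤ |t| * n := by gcongr
  have hup : P.real {ω | n * (a + b) ≤ S ω} ≤ Real.exp (-(n * (θ * b - θ ^ 2 * a))) := by
    refine (measure_ge_le_exp_mul_mgf _ hθ0 (hint θ)).trans ?_
    refine (mul_le_mul_of_nonneg_left (mgf_sum_comp_le hX hindep hφ hφ0 hφ1
      (by rwa [abs_of_nonneg hθ0]) n) (Real.exp_pos _).le).trans (le_of_eq ?_)
    rw [← Real.exp_add]; congr 1; ring
  have hlow : P.real {ω | S ω ≤ n * (a - b)} ≤ Real.exp (-(n * (θ * b - θ ^ 2 * a))) := by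
    refine (measure_le_le_exp_mul_mgf _ (neg_nonpos.2 hθ0) (hint (-θ))).trans ?_
    refine (mul_le_mul_of_nonneg_left (mgf_sum_comp_le hX hindep hφ hφ0 hφ1
      (by rwa [abs_neg, abs_of_nonneg hθ0]) n) (Real.exp_pos _).le).trans (le_of_eq ?_)
    rw [← Real.exp_add]; congr 1; ring
  calc _ ≤ P.real ({ω | n * (a + b) ≤ S ω} ∪ {ω | S ω ≤ n * (a - b)}) := by
        refine measureReal_mono fun ω hω => ?_
        rw [mem_ofPred_eq, ← hSω] at hω
        rcases le_abs.1 hω with h | h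
        · left; simp only [mem_ofPred_eq]; linarith
        · right; simp only [mem_ofPred_eq]; linarith
    _ ≤ _ := (measureReal_union_le _ _).trans (by linarith)

/-- An independent sequence almost surely hits each set of positive measure. -/
theorem ae_exists_mem_of_measure_pos (hX : ∀ i, HasLaw (X i) μ P) (hindep : iIndepFun X P)
    {U : Set E} (hU : MeasurableSet U) (hμU : μ U ≠ 0) : ∀ᵐ ω ∂P, ∃ i, X i ω ∈ U := by
  have hlt : μ Uᶜ < 1 := by
    rw [prob_compl_eq_one_sub hU]
    exact ENNReal.sub_lt_self (by simp) (by simp) hμU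
  have hle : ∀ n : ℕ, P {ω | ¬∃ i, X i ω ∈ U} ≤ μ Uᶜ ^ n := fun n => by
    calc P {ω | ¬∃ i, X i ω ∈ U} ≤ P (⋂ i ∈ Finset.range n, X i ⁻¹' Uᶜ) := by
          refine measure_mono fun ω hω => ?_
          simp only [mem_ofPred_eq, not_exists] at hω
          simp [hω]
      _ = ∏ i ∈ Finset.range n, P (X i ⁻¹' Uᶜ) :=
          hindep.measure_inter_preimage_eq_mul _ (fun i _ => hU.compl)
      _ = μ Uᶜ ^ n := by
          have h1 : ∀ i, P (X i ⁻¹' Uᶜ) = μ Uᶜ := fun i =>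
            (hX i).measure_eq (p := fun x => x ∈ Uᶜ) hU.compl
          simp only [h1, Finset.prod_const, Finset.card_range]
  rw [ae_iff]
  exact le_antisymm (ge_of_tendsto' (ENNReal.tendsto_pow_atTop_nhds_zero_of_lt_one hlt) hle)
    zero_le

end Chernoff

/-! ### Nets and discretization -/

/-- The derivative of `exp(-x²)` is at most `1` in modulus, because `2|x| ≤ 1 + x² ≤ exp(x²)`. -/
theorem abs_gaussianKernel_sub_le (m : ℕ) (u v : ℝ) :
    |gaussianKernel m u - gaussianKernel m v| ≤ |u - v| := by
  have hd : ∀ x : ℝ, HasDerivAt (fun x : ℝ => Real.exp (-x ^ 2)) (Real.exp (-x ^ 2) * -(2 * x)) x :=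
    fun x => by simpa using ((hasDerivAt_pow 2 x).neg).exp
  have hb : ∀ x : ℝ, ‖Real.exp (-x ^ 2) * -(2 * x)‖ ≤ 1 := fun x => by
    rw [norm_mul, Real.norm_of_nonneg (Real.exp_pos _).le, Real.norm_eq_abs, abs_neg, Real.exp_neg,
      inv_mul_le_iff₀ (Real.exp_pos _), mul_one, abs_le]
    have := Real.add_one_le_exp (x ^ 2)
    constructor <;> nlinarith [sq_nonneg (x - 1), sq_nonneg (x + 1)]
  have h := Convex.norm_image_sub_le_of_norm_hasDerivWithin_le (s := univ)
    (fun x _ => (hd x).hasDerivWithinAt) (fun x _ => hb x) convex_univ (mem_univ v) (mem_univ u)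
  unfold gaussianKernel
  rw [← mul_sub, abs_mul, abs_of_pos (by positivity)]
  rw [Real.norm_eq_abs, Real.norm_eq_abs, one_mul] at h
  calc _ ≤ 1 * |u - v| := mul_le_mul (rpow_pi_le_one m) h (abs_nonneg _) zero_le_one
    _ = _ := one_mul _

/-- A bounded subset of `ℝ^d` has nets of polynomial size. -/
theorem _root_.Bornology.IsBounded.exists_finset_net {d : ℕ} {M : Set (Euc d)}
    (hM : Bornology.IsBounded M) :
    ∃ C : ℕ, ∀ n : ℕ, 1 ≤ n → ∃ G : Finset (Euc d), ↑G ⊆ M ∧ G.card ≤ C * n ^ d ∧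
      ∀ x ∈ M, ∃ g ∈ G, dist x g ≤ 1 / n := by
  obtain ⟨R₀, hR₀⟩ := hM.subset_closedBall 0
  obtain ⟨R, hR⟩ := exists_nat_ge R₀
  refine ⟨(2 * (R * (d + 1)) + 1) ^ d, fun n hn => ?_⟩
  have hn0 : (0 : ℝ) < n := by exact_mod_cast hn
  -- Grid cells of side `1/k` have diameter at most `√d / k ≤ 1/n`. One point of `M` is chosen in
  -- each cell that meets `M`, so the net lies in `M`.
  set k : ℕ := (d + 1) * n with hk
  have hk0 : (0 : ℝ) < k := by rw [hk]; push_cast; positivity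
  let F : Euc d → (Fin d → ℤ) := fun x i => ⌊x i * k⌋
  let B : Finset (Fin d → ℤ) := Fintype.piFinset fun _ => Finset.Icc (-(R * k : ℤ)) (R * k)
  have hFB : ∀ x ∈ M, F x ∈ B := fun x hx => by
    refine Fintype.mem_piFinset.2 fun i => Finset.mem_Icc.2 ?_
    have h1 : ‖x‖ ≤ R := by
      have := hR₀ hx
      rw [mem_closedBall_zero_iff] at this
      exact this.trans hR
    have h2 := abs_le.1 ((PiLp.norm_apply_le x i).trans h1)
    constructor
    · rw [Int.le_floor]; push_cast; nlinarith [h2.1]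
    · have : ((⌊x i * k⌋ : ℤ) : ℝ) ≤ R * k := (Int.floor_le _).trans (by nlinarith [h2.2])
      exact_mod_cast this
  have hfin : (F '' M).Finite := B.finite_toSet.subset (by rintro _ ⟨x, hx, rfl⟩; exact hFB x hx)
  refine ⟨hfin.toFinset.image (Function.invFunOn F M), ?_, ?_, fun x hx => ?_⟩
  · intro y hy
    simp only [Finset.coe_image, Finite.coe_toFinset] at hy
    obtain ⟨z, hz, rfl⟩ := hy
    exact Function.invFunOn_mem hz
  · calc _ ≤ hfin.toFinset.card := Finset.card_image_le
      _ ≤ B.card := Finset.card_le_card fun z hz => by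
          obtain ⟨x, hx, rfl⟩ := hfin.mem_toFinset.1 hz
          exact hFB x hx
      _ = (2 * (R * k) + 1) ^ d := by
          simp only [B, Fintype.card_piFinset, Int.card_Icc, Finset.prod_const, Finset.card_univ,
            Fintype.card_fin]
          congr 1; omega
      _ ≤ ((2 * (R * (d + 1)) + 1) * n) ^ d := by
          gcongr
          rw [hk]; nlinarith
      _ = _ := by rw [mul_pow]
  · have hz : F x ∈ F '' M := ⟨x, hx, rfl⟩
    refine ⟨Function.invFunOn F M (F x), Finset.mem_image_of_mem _ (hfin.mem_toFinset.2 hz), ?_⟩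
    set g := Function.invFunOn F M (F x)
    have hg : F g = F x := Function.invFunOn_eq hz
    have hi : ∀ i, dist (x i) (g i) ≤ 1 / k := fun i => by
      have h1 : ⌊g i * k⌋ = ⌊x i * k⌋ := congrFun hg i
      have h2 := Int.abs_sub_lt_one_of_floor_eq_floor h1.symm
      rw [← sub_mul, abs_mul, abs_of_pos hk0] at h2
      rw [Real.dist_eq, le_div_iff₀ hk0]
      exact h2.le
    rw [EuclideanSpace.dist_eq]
    refine Real.sqrt_le_iff.2 ⟨by positivity, ?_⟩
    calc ∑ i, dist (x i) (g i) ^ 2 ≤ ∑ i : Fin d, (1 / (k : ℝ)) ^ 2 := by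
          gcongr with i
          exact hi i
      _ = d * (1 / (k : ℝ)) ^ 2 := by simp
      _ ≤ (d + 1) ^ 2 * (1 / (k : ℝ)) ^ 2 := by
          gcongr
          nlinarith [(d.cast_nonneg : (0 : ℝ) ≤ d)]
      _ = (1 / (n : ℝ)) ^ 2 := by
          rw [hk]; push_cast; field_simp

/-- A compact `0`-dimensional submanifold is finite. -/
theorem IsCompactC2Submanifold.finite_of_zero {d : ℕ} {M : Set (Euc d)}
    (hM : IsCompactC2Submanifold 0 M) : M.Finite := by
  have hloc : ∀ p ∈ M, ∃ U ∈ 𝓝 p, U ∩ M ⊆ {p} := fun p hp => by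
    obtain ⟨T, hT, hη, -⟩ := hM.exists_tangent hp
    obtain ⟨U, hU, h⟩ := hη (1 / 2) (by norm_num)
    refine ⟨U, hU, fun x hx => ?_⟩
    have h1 := h x hx p ⟨mem_of_mem_nhds hU, hp⟩
    have : Subsingleton T := Module.finrank_zero_iff.1 hT
    rw [Subsingleton.elim (T.orthogonalProjectionOnto (x - p)) 0, norm_zero] at h1
    have h2 : ‖x - p‖ = 0 := le_antisymm (by linarith) (norm_nonneg _)
    exact sub_eq_zero.1 (norm_eq_zero.1 h2)
  choose! U hU hUM using hloc
  obtain ⟨t, ht, hcov⟩ := hM.isCompact.elim_nhds_subcover U hU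
  refine t.finite_toSet.subset fun x hx => ?_
  obtain ⟨p, hp, hxp⟩ := mem_iUnion₂.1 (hcov hx)
  rw [hUM p (ht p hp) ⟨hxp, hx⟩]
  exact hp

/-- There are nets of polynomial size on which the kernel of bandwidth `h n` is well
approximated. -/
theorem IsCompactC2Submanifold.exists_kernel_net {d m : ℕ} {M : Set (Euc d)}
    (hM : IsCompactC2Submanifold m M) {h : ℕ → ℝ} (hpos : ∀ n, 0 < h n)
    (h0 : Tendsto h atTop (𝓝 0))
    (hrate : Tendsto (fun n : ℕ => n * h n ^ m / Real.log n) atTop atTop) {ε : ℝ} (hε : 0 < ε) :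
    ∃ C q : ℕ, ∀ᶠ n : ℕ in atTop, ∃ G : Finset (Euc d), ↑G ⊆ M ∧ G.card ≤ C * n ^ q ∧
      ∀ x ∈ M, ∃ g ∈ G, ∀ y,
        |gaussianKernel m (‖x - y‖ / h n) - gaussianKernel m (‖g - y‖ / h n)| ≤ ε * h n ^ m := by
  -- For `m = 0` the rate condition gives no lower bound on `h`, so a grid of polynomial size may be
  -- too coarse; but `M` is then finite and is its own net.
  rcases Nat.eq_zero_or_pos m with rfl | hm
  · refine ⟨hM.finite_of_zero.toFinset.card, 0, Eventually.of_forall fun n =>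
      ⟨hM.finite_of_zero.toFinset, by simp, by simp, fun x hx => ⟨x, by simpa using hx, fun y => ?_⟩⟩⟩
    simpa using hε.le
  · obtain ⟨C, hC⟩ := hM.isCompact.isBounded.exists_finset_net
    refine ⟨C, 3 * d, ?_⟩
    have hlog : Tendsto (fun n : ℕ => Real.log n) atTop atTop :=
      Real.tendsto_log_atTop.comp tendsto_natCast_atTop_atTop
    filter_upwards [eventually_ge_atTop 1, h0.eventually_lt_const one_pos,
      hrate.eventually_ge_atTop 1, hlog.eventually_ge_atTop 1,
      tendsto_natCast_atTop_atTop.eventually_ge_atTop ε⁻¹] with n hn1 hh1 hr hl hnε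
    -- The mesh `n⁻³` is split into three factors `1/n`, bounded by `ε`, `h^m` and `h`; the last two
    -- use `n h^m ≥ log n ≥ 1` and `h < 1`.
    obtain ⟨G, hGM, hGc, hG⟩ := hC (n ^ 3) (Nat.one_le_pow _ _ hn1)
    refine ⟨G, hGM, by rwa [← pow_mul] at hGc, fun x hx => ?_⟩
    obtain ⟨g, hg, hxg⟩ := hG x hx
    refine ⟨g, hg, fun y => (abs_gaussianKernel_sub_le m _ _).trans ?_⟩
    have hh := hpos n
    have hn0 : (0 : ℝ) < n := by exact_mod_cast hn1
    have h1 : 1 ≤ n * h n ^ m := by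
      rw [le_div_iff₀ (by linarith), one_mul] at hr
      exact hl.trans hr
    have h2 : h n ^ m ≤ h n := pow_le_of_le_one hh.le hh1.le hm.ne'
    have h3 : 1 / (n : ℝ) ≤ h n ^ m := by rw [div_le_iff₀ hn0]; linarith
    have h4 : 1 / (n : ℝ) ≤ h n := h3.trans h2
    have h5 : 1 / (n : ℝ) ≤ ε := by
      rw [one_div]; exact inv_le_of_inv_le₀ hε hnε
    rw [← sub_div, abs_div, abs_of_pos hh, div_le_iff₀ hh]
    calc |‖x - y‖ - ‖g - y‖| ≤ ‖x - y - (g - y)‖ := abs_norm_sub_norm_le _ _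
      _ = dist x g := by rw [sub_sub_sub_cancel_right, dist_eq_norm]
      _ ≤ 1 / (n ^ 3 : ℕ) := hxg
      _ = 1 / (n : ℝ) * (1 / n) * (1 / n) := by push_cast; field_simp
      _ ≤ ε * h n ^ m * h n := by gcongr

theorem densityEstimator_eq {d m : ℕ} (h : ℝ) (n : ℕ) (X : ℕ → Euc d) (x : Euc d) :
    densityEstimator m h n X x =
      (n * h ^ m)⁻¹ * ∑ i ∈ Finset.range n, gaussianKernel m (‖x - X i‖ / h) := by
  unfold densityEstimator gaussianKernel
  rw [one_div]

theorem abs_densityEstimator_sub_le {d m : ℕ} {h : ℝ} (hh : 0 < h) {n : ℕ} (hn : 1 ≤ n)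
    (X : ℕ → Euc d) {x g : Euc d} {ε : ℝ}
    (hxg : ∀ y, |gaussianKernel m (‖x - y‖ / h) - gaussianKernel m (‖g - y‖ / h)| ≤ ε * h ^ m) :
    |densityEstimator m h n X x - densityEstimator m h n X g| ≤ ε := by
  have hn0 : (0 : ℝ) < n := by exact_mod_cast hn
  rw [densityEstimator_eq, densityEstimator_eq, ← mul_sub, ← Finset.sum_sub_distrib, abs_mul,
    abs_of_pos (by positivity), inv_mul_le_iff₀ (by positivity)]
  calc _ ≤ ∑ i ∈ Finset.range n, ε * h ^ m :=
        (Finset.abs_sum_le_sum_abs _ _).trans (Finset.sum_le_sum fun i _ => hxg _)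
    _ = _ := by simp; ring

theorem abs_smoothed_sub_le {d m : ℕ} {μ : Measure (Euc d)} [IsProbabilityMeasure μ] {h : ℝ}
    (hh : 0 < h) {x g : Euc d} {ε : ℝ}
    (hxg : ∀ y, |gaussianKernel m (‖x - y‖ / h) - gaussianKernel m (‖g - y‖ / h)| ≤ ε * h ^ m) :
    |smoothed μ m h x - smoothed μ m h g| ≤ ε := by
  rw [smoothed, smoothed, ← mul_sub, ← integral_sub (integrable_gaussianKernel m h x)
    (integrable_gaussianKernel m h g), abs_mul, abs_of_pos (by positivity),
    inv_mul_le_iff₀ (by positivity), ← Real.norm_eq_abs]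
  refine (norm_integral_le_of_norm_le_const (Eventually.of_forall hxg)).trans (le_of_eq ?_)
  simp; ring

/-! ### Uniform deviation of the estimator from its mean -/

section Uniform

variable {Ω : Type*} [MeasurableSpace Ω] {P : Measure Ω} [IsProbabilityMeasure P] {d m : ℕ}
  {M : Set (Euc d)} {μ : Measure (Euc d)} [IsProbabilityMeasure μ] {X : ℕ → Ω → Euc d}

/-- The choice `θ = min 1 (ε / (2C))` makes the quadratic term of the Bernstein exponent at most
half of the linear one, leaving a constant multiple of `n h^m`. -/
theorem measureReal_abs_densityEstimator_sub_smoothed_le (hX : ∀ i, HasLaw (X i) μ P)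
    (hindep : iIndepFun X P) {h : ℝ} (hh : 0 < h) {n : ℕ} (hn : 1 ≤ n) {x : Euc d} {C ε : ℝ}
    (hC : 0 < C) (hε : 0 < ε) (hx : smoothed μ m h x ≤ C) :
    P.real {ω | ε ≤ |densityEstimator m h n (fun i => X i ω) x - smoothed μ m h x|} ≤
      2 * Real.exp (-(min 1 (ε / (2 * C)) * (ε / 2) * (n * h ^ m))) := by
  have hn0 : (0 : ℝ) < n := by exact_mod_cast hn
  have hhm : 0 < h ^ m := by positivity
  set θ := min 1 (ε / (2 * C)) with hθ
  have hθ0 : 0 < θ := lt_min one_pos (by positivity)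
  set a := ∫ y, gaussianKernel m (‖x - y‖ / h) ∂μ with ha
  have has : a = h ^ m * smoothed μ m h x := by rw [smoothed, mul_inv_cancel_left₀ hhm.ne']
  have hset : {ω | ε ≤ |densityEstimator m h n (fun i => X i ω) x - smoothed μ m h x|} =
      {ω | n * (h ^ m * ε) ≤ |∑ i ∈ Finset.range n, gaussianKernel m (‖x - X i ω‖ / h) - n * a|} := by
    ext ω
    have h1 : ∑ i ∈ Finset.range n, gaussianKernel m (‖x - X i ω‖ / h) - n * a =
        (n * h ^ m) * (densityEstimator m h n (fun i => X i ω) x - smoothed μ m h x) := by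
      rw [mul_sub, densityEstimator_eq, mul_inv_cancel_left₀ (by positivity), has]
      ring
    rw [mem_ofPred_eq, mem_ofPred_eq, h1, abs_mul, abs_of_pos (by positivity : 0 < n * h ^ m),
      ← mul_assoc, mul_le_mul_iff_right₀ (by positivity)]
  rw [hset]
  refine (measureReal_abs_sum_sub_ge_le (φ := fun y => gaussianKernel m (‖x - y‖ / h)) hX hindep
    (by fun_prop) (fun y => (gaussianKernel_pos m _).le) (fun y => gaussianKernel_le_one m _)
    hθ0.le (min_le_left _ _) n (h ^ m * ε)).trans ?_
  rw [← ha, has]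
  have h2 : θ * C ≤ ε / 2 := by
    calc θ * C ≤ ε / (2 * C) * C := by gcongr; exact min_le_right _ _
      _ = ε / 2 := by field_simp
  have h3 : θ ^ 2 * smoothed μ m h x ≤ θ * (ε / 2) := by
    calc θ ^ 2 * smoothed μ m h x ≤ θ ^ 2 * C := by gcongr
      _ = θ * (θ * C) := by ring
      _ ≤ _ := by gcongr
  have h4 : n * (θ * (h ^ m * ε) - θ ^ 2 * (h ^ m * smoothed μ m h x)) =
      (n * h ^ m) * (θ * ε - θ ^ 2 * smoothed μ m h x) := by ring
  rw [h4, mul_comm (θ * (ε / 2))]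
  have h5 : θ * (ε / 2) ≤ θ * ε - θ ^ 2 * smoothed μ m h x := by linarith
  gcongr

/-- The density estimator is almost surely uniformly close to its mean. -/
theorem ae_eventually_abs_densityEstimator_sub_smoothed_le (hM : IsCompactC2Submanifold m M)
    (hX : ∀ i, HasLaw (X i) μ P) (hindep : iIndepFun X P) {h : ℕ → ℝ} (hpos : ∀ n, 0 < h n)
    (h0 : Tendsto h atTop (𝓝 0))
    (hrate : Tendsto (fun n : ℕ => n * h n ^ m / Real.log n) atTop atTop) {C : ℝ} (hC : 0 < C)
    (hbound : ∀ᶠ n in atTop, ∀ x ∈ M, smoothed μ m (h n) x ≤ C) {ε : ℝ} (hε : 0 < ε) :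
    ∀ᵐ ω ∂P, ∀ᶠ n in atTop, ∀ x ∈ M,
      |densityEstimator m (h n) n (fun i => X i ω) x - smoothed μ m (h n) x| ≤ 3 * ε := by
  obtain ⟨N, q, hnet⟩ := hM.exists_kernel_net hpos h0 hrate hε
  set c := min 1 (ε / (2 * C)) * (ε / 2) with hc
  have hc0 : 0 < c := mul_pos (lt_min one_pos (by positivity)) (by positivity)
  -- Moving to a net point costs `ε` for the estimator and `ε` for its mean, so a deviation above `3
  -- * ε` somewhere forces one of at least `ε` on the net.
  let bad : ℕ → Set Ω := fun n => {ω | ∃ x ∈ M,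
    3 * ε < |densityEstimator m (h n) n (fun i => X i ω) x - smoothed μ m (h n) x|}
  have hbad : ∀ᶠ n : ℕ in atTop, ‖P.real (bad n)‖ ≤ (2 * N) * (1 / (n : ℝ) ^ 2) := by
    have hlog : Tendsto (fun n : ℕ => Real.log n) atTop atTop :=
      Real.tendsto_log_atTop.comp tendsto_natCast_atTop_atTop
    filter_upwards [hnet, hbound, eventually_ge_atTop 1,
      hrate.eventually_ge_atTop ((q + 2 : ℕ) / c), hlog.eventually_ge_atTop 1]
      with n ⟨G, hGM, hGc, hG⟩ hb hn hr hl
    have hn0 : (0 : ℝ) < n := by exact_mod_cast hn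
    rw [Real.norm_of_nonneg measureReal_nonneg]
    have hsub : bad n ⊆ ⋃ g ∈ G,
        {ω | ε ≤ |densityEstimator m (h n) n (fun i => X i ω) g - smoothed μ m (h n) g|} := by
      rintro ω ⟨x, hx, hxω⟩
      obtain ⟨g, hg, hxg⟩ := hG x hx
      refine mem_iUnion₂.2 ⟨g, hg, ?_⟩
      have h1 := abs_le.1 (abs_densityEstimator_sub_le (hpos n) hn (fun i => X i ω) hxg)
      have h2 := abs_le.1 (abs_smoothed_sub_le (μ := μ) (hpos n) hxg)
      rw [mem_ofPred_eq]
      rcases lt_abs.1 hxω with h3 | h3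
      · exact le_abs.2 (Or.inl (by linarith))
      · exact le_abs.2 (Or.inr (by linarith))
    -- The net absorbs `n^q`, and the remaining `n⁻²` is summable.
    have hexp : Real.exp (-(c * (n * h n ^ m))) ≤ ((n : ℝ) ^ (q + 2))⁻¹ := by
      rw [Real.exp_neg]
      refine inv_anti₀ (by positivity) ?_
      rw [div_le_iff₀ hc0, div_mul_eq_mul_div, le_div_iff₀ (by linarith)] at hr
      calc (n : ℝ) ^ (q + 2) = Real.exp ((q + 2 : ℕ) * Real.log n) := by
            rw [Real.exp_nat_mul, Real.exp_log hn0]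
        _ ≤ _ := Real.exp_le_exp.2 (by linarith)
    calc P.real (bad n) ≤ ∑ g ∈ G, P.real
          {ω | ε ≤ |densityEstimator m (h n) n (fun i => X i ω) g - smoothed μ m (h n) g|} :=
          (measureReal_mono hsub (measure_ne_top _ _)).trans (measureReal_biUnion_finset_le _ _)
      _ ≤ ∑ g ∈ G, 2 * Real.exp (-(c * (n * h n ^ m))) := Finset.sum_le_sum fun g hg =>
          measureReal_abs_densityEstimator_sub_smoothed_le hX hindep (hpos n) hn hC hε
            (hb g (hGM hg))
      _ = G.card * (2 * Real.exp (-(c * (n * h n ^ m)))) := by simp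
      _ ≤ (N * n ^ q : ℕ) * (2 * ((n : ℝ) ^ (q + 2))⁻¹) := by gcongr
      _ = (2 * N) * (1 / (n : ℝ) ^ 2) := by push_cast; rw [pow_add]; field_simp
  have hsum : Summable fun n => P.real (bad n) :=
    ((Real.summable_one_div_nat_pow.2 one_lt_two).mul_left (2 * (N : ℝ))).of_norm_bounded_eventually_nat
      hbad
  have htsum : ∑' n, P (bad n) ≠ ∞ := by
    have := hsum.tsum_ofReal_ne_top
    simpa only [ofReal_measureReal (measure_ne_top P _)] using this
  filter_upwards [ae_eventually_notMem htsum] with ω hω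
  filter_upwards [hω] with n hn x hx
  by_contra hcon
  exact hn ⟨x, hx, not_le.1 hcon⟩

end Uniform

/-! ### Hulls, level sets and Hausdorff convergence -/

section

variable {d m : ℕ} {M : Set (Euc d)} {f : Euc d → ℝ} {lam : ℝ}

theorem subset_rConvexHull {r : ℝ} {A : Set (Euc d)} (hA : A ⊆ M) : A ⊆ rConvexHull M r A :=
  fun _ hx => ⟨hA hx, fun _ _ hdisj => disjoint_right.1 hdisj hx⟩

theorem rConvexHull_mono {r : ℝ} {A B : Set (Euc d)} (hAB : A ⊆ B) :
    rConvexHull M r A ⊆ rConvexHull M r B :=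
  fun _ hx => ⟨hx.1, fun c hc hdisj => hx.2 c hc (hdisj.mono_right hAB)⟩

/-- Sets that are close in the Euclidean sense are close in the geodesic Hausdorff distance. -/
theorem IsCompactC2Submanifold.exists_geodesicHausdorffEDist_le (hM : IsCompactC2Submanifold m M)
    {ε : ℝ} (hε : 0 < ε) :
    ∃ δ > 0, ∀ A ⊆ M, ∀ C ⊆ M, (∀ a ∈ A, ∃ c ∈ C, dist a c < δ) →
      (∀ c ∈ C, ∃ a ∈ A, dist c a < δ) → geodesicHausdorffEDist M A C ≤ ENNReal.ofReal ε := by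
  obtain ⟨δ, hδ, h⟩ := hM.exists_geodesicEDist_le hε
  refine ⟨δ, hδ, fun A hA C hC hAC hCA => max_le (iSup₂_le fun a ha => ?_)
    (iSup₂_le fun c hc => ?_)⟩
  · obtain ⟨c, hc, hac⟩ := hAC a ha
    exact (iInf₂_le c hc).trans (h a (hA ha) c (hC hc) hac)
  · obtain ⟨a, ha, hca⟩ := hCA c hc
    exact (iInf₂_le a ha).trans (h c (hC hc) a (hA ha) hca)

theorem isCompact_levelSet (hM : IsCompact M) (hf : ContinuousOn f M) :
    IsCompact (levelSet M f lam) :=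
  hM.of_isClosed_subset (hf.preimage_isClosed_of_isClosed hM.isClosed isClosed_Ici) fun _ hx => hx.1

/-- The level sets at slightly lower levels are close to the level set. -/
theorem exists_levelSet_sub_near (hM : IsCompact M) (hf : ContinuousOn f M) {δ : ℝ} (hδ : 0 < δ) :
    ∃ ε > 0, ∀ x ∈ M, lam - ε ≤ f x → ∃ y ∈ levelSet M f lam, dist x y < δ := by
  -- On the compact set `K` of points far from the level set, `f` has a maximum below `lam` unless
  -- `K` is empty; half of that gap is the required `ε`.
  set K : Set (Euc d) := M ∩ ⋂ y ∈ levelSet M f lam, {x | δ ≤ dist x y} with hK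
  have hKc : IsCompact K := hM.inter_right <| isClosed_biInter fun y _ =>
    isClosed_le continuous_const (by fun_prop)
  have hKf : ∀ x ∈ K, f x < lam := fun x hx => by
    by_contra hcon
    have h1 : δ ≤ dist x x := mem_iInter₂.1 hx.2 x ⟨hx.1, not_lt.1 hcon⟩
    rw [dist_self] at h1
    exact absurd h1 (not_le.2 hδ)
  have hfar : ∀ x ∈ M, x ∉ K → ∃ y ∈ levelSet M f lam, dist x y < δ := fun x hx hxK => by
    by_contra! hcon
    exact hxK ⟨hx, mem_iInter₂.2 hcon⟩
  rcases K.eq_empty_or_nonempty with hemp | hne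
  · exact ⟨1, one_pos, fun x hx _ => hfar x hx (by rw [hemp]; exact notMem_empty x)⟩
  · obtain ⟨x₀, hx₀, hmax⟩ := hKc.exists_isMaxOn hne (hf.mono inter_subset_left)
    have hlt := hKf x₀ hx₀
    refine ⟨(lam - f x₀) / 2, by linarith, fun x hx hfx => hfar x hx fun hxK => ?_⟩
    have : f x ≤ f x₀ := hmax hxK
    linarith

/-- The level set is contained in the closure of the set of interior points at higher levels. -/
theorem IsCompactC2Submanifold.levelSet_subset_closure (hM : IsCompactC2Submanifold m M)
    (hf : ContinuousOn f M)
    (hlevel : ∀ x ∈ M, f x = lam → ∃ a : ℕ → Euc d,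
      (∀ j, IsInteriorPt m M (a j) ∧ lam < f (a j)) ∧ Tendsto a atTop (𝓝 x)) :
    levelSet M f lam ⊆ closure {b | IsInteriorPt m M b ∧ lam < f b} := by
  rintro x ⟨hx, hfx⟩
  rcases hfx.eq_or_lt with heq | hlt
  · obtain ⟨a, ha, hax⟩ := hlevel x hx heq.symm
    exact mem_closure_of_tendsto hax (Eventually.of_forall ha)
  · rw [mem_closure_iff_frequently]
    have h1 := mem_closure_iff_frequently.1 (hM.mem_closure_interiorPt hx)
    have h2 : ∀ᶠ y in 𝓝[M] x, lam < f y := (hf x hx).eventually_const_lt hlt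
    rw [eventually_nhdsWithin_iff] at h2
    exact (h1.and_eventually h2).mono fun y hy => ⟨hy.1, hy.2 hy.1.1⟩

/-- If the sample is dense and the functions `g n` are asymptotically above the level near the
points where `f` is, then the sample points above the level approximate the level set. -/
theorem eventually_exists_samplePointsAbove_near (hM : IsCompact M) (hf : ContinuousOn f M)
    (hcl : levelSet M f lam ⊆ closure {b | IsInteriorPt m M b ∧ lam < f b})
    {X : ℕ → Euc d} (hXM : ∀ i, X i ∈ M)
    (hX : ∀ b ∈ M, ∀ V ∈ 𝓝 b, ∃ i, X i ∈ V) {g : ℕ → Euc d → ℝ}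
    (hg : ∀ b, IsInteriorPt m M b → lam < f b →
      ∃ U ∈ 𝓝 b, ∀ᶠ n in atTop, ∀ x ∈ U ∩ M, lam < g n x) {δ : ℝ} (hδ : 0 < δ) :
    ∀ᶠ n in atTop, ∀ x ∈ levelSet M f lam, ∃ y ∈ samplePointsAbove n X (g n) lam, dist x y < δ := by
  -- The distance is `δ/4` to an interior point at a higher level and `δ/4` more to a sample point;
  -- the other `δ/2` is for a finite cover, which makes the threshold on `n` uniform.
  have hloc : ∀ x ∈ levelSet M f lam, ∀ᶠ n in atTop, ∃ y ∈ samplePointsAbove n X (g n) lam,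
      dist x y < δ / 2 := fun x hx => by
    obtain ⟨b, ⟨hb, hfb⟩, hxb⟩ := Metric.mem_closure_iff.1 (hcl hx) (δ / 4) (by positivity)
    obtain ⟨U, hU, hgU⟩ := hg b hb hfb
    obtain ⟨i, hi⟩ := hX b hb.1 _ (inter_mem hU (Metric.ball_mem_nhds b (show 0 < δ / 4 by positivity)))
    filter_upwards [hgU, eventually_gt_atTop i] with n hn hin
    refine ⟨X i, ⟨i, hin, rfl, hn _ ⟨hi.1, hXM i⟩⟩, ?_⟩
    have := Metric.mem_ball'.1 hi.2
    linarith [dist_triangle x b (X i)]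
  obtain ⟨t, ht, hcov⟩ := (isCompact_levelSet (lam := lam) hM hf).elim_nhds_subcover
    (fun x => Metric.ball x (δ / 2)) fun x _ => Metric.ball_mem_nhds x (by positivity)
  filter_upwards [(Filter.eventually_all_finset t).2 fun x hx => hloc x (ht x hx)] with n hn x hx
  obtain ⟨c, hc, hxc⟩ := mem_iUnion₂.1 (hcov hx)
  obtain ⟨y, hy, hcy⟩ := hn c hc
  have := Metric.mem_ball.1 hxc
  exact ⟨y, hy, by linarith [dist_triangle x c y]⟩

/-- The smoothed density is asymptotically at most the density, uniformly on `M`. -/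
theorem eventually_smoothed_le_add (hM : IsCompactC2Submanifold m M) (hf : ContinuousOn f M)
    (hf0 : ∀ x ∈ M, 0 ≤ f x) [IsProbabilityMeasure (densityLaw m M f)] {ε : ℝ} (hε : 0 < ε) :
    ∀ᶠ h in 𝓝[>] (0 : ℝ), ∀ x ∈ M, smoothed (densityLaw m M f) m h x ≤ f x + ε := by
  have hloc : ∀ p ∈ M, ∃ U ∈ 𝓝 p, ∀ᶠ h in 𝓝[>] (0 : ℝ), ∀ x ∈ U ∩ M,
      smoothed (densityLaw m M f) m h x ≤ f x + ε := fun p hp => by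
    obtain ⟨U, hU, hUh⟩ := eventually_smoothed_le hM hf hf0 hp (half_pos hε)
    have h2 : ∀ᶠ y in 𝓝[M] p, f p - ε / 2 < f y :=
      (hf p hp).eventually_const_lt (by linarith)
    rw [eventually_nhdsWithin_iff] at h2
    refine ⟨_, inter_mem hU h2, ?_⟩
    filter_upwards [hUh] with h hh x hx
    have h3 := hh x ⟨hx.1.1, hx.2⟩
    have h4 := hx.1.2 hx.2
    linarith
  choose! U hU hUh using hloc
  obtain ⟨t, ht, hcov⟩ := hM.isCompact.elim_nhds_subcover U hU
  filter_upwards [(Filter.eventually_all_finset t).2 fun x hx => hUh x (ht x hx)] with h hh x hx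
  obtain ⟨c, hc, hxc⟩ := mem_iUnion₂.1 (hcov hx)
  exact hh c hc x ⟨hxc, hx⟩

/-- A sequence of sets of points of `M` converges to a compact set in the geodesic Hausdorff
distance as soon as it does so in the Euclidean sense; two such sequences approach each other. -/
theorem IsCompactC2Submanifold.tendsto_geodesicHausdorffEDist (hM : IsCompactC2Submanifold m M)
    {A C : ℕ → Set (Euc d)} {L : Set (Euc d)} (hA : ∀ n, A n ⊆ M) (hC : ∀ n, C n ⊆ M)
    (hAL : ∀ δ > 0, ∀ᶠ n in atTop, (∀ a ∈ A n, ∃ x ∈ L, dist a x < δ) ∧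
      ∀ x ∈ L, ∃ a ∈ A n, dist x a < δ)
    (hCL : ∀ δ > 0, ∀ᶠ n in atTop, (∀ c ∈ C n, ∃ x ∈ L, dist c x < δ) ∧
      ∀ x ∈ L, ∃ c ∈ C n, dist x c < δ) :
    Tendsto (fun n => geodesicHausdorffEDist M (A n) (C n)) atTop (𝓝 0) := by
  refine ENNReal.tendsto_nhds_zero.2 fun ε hε => ?_
  obtain ⟨ε', hε', hle⟩ : ∃ ε' : ℝ, 0 < ε' ∧ ENNReal.ofReal ε' ≤ ε := by
    refine ⟨(min ε 1).toReal, ENNReal.toReal_pos (lt_min hε one_pos).ne' (by simp), ?_⟩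
    rw [ENNReal.ofReal_toReal (by simp)]
    exact min_le_left _ _
  obtain ⟨δ, hδ, h⟩ := hM.exists_geodesicHausdorffEDist_le hε'
  filter_upwards [hAL (δ / 2) (by positivity), hCL (δ / 2) (by positivity)] with n hAn hCn
  refine (h _ (hA n) _ (hC n) (fun a ha => ?_) (fun c hc => ?_)).trans hle
  · obtain ⟨x, hx, hax⟩ := hAn.1 a ha
    obtain ⟨c, hc, hxc⟩ := hCn.2 x hx
    exact ⟨c, hc, by linarith [dist_triangle a x c]⟩
  · obtain ⟨x, hx, hcx⟩ := hCn.1 c hc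
    obtain ⟨a, ha, hxa⟩ := hAn.2 x hx
    exact ⟨a, ha, by linarith [dist_triangle c x a]⟩

end

end LevelSet

/-! ### Assembly of the proof -/

theorem theorem5 {d m : ℕ} {M : Set (Euc d)} (hM : IsCompactC2Submanifold m M)
    {f : Euc d → ℝ} (hf : ContDiffOn ℝ 2 f M) (hf0 : ∀ x ∈ M, 0 ≤ f x)
    (hsupp : (densityLaw m M f).support = M)
    {Ω : Type*} [MeasurableSpace Ω] {P : Measure Ω} [IsProbabilityMeasure P]
    {X : ℕ → Ω → Euc d} (hlaw : ∀ i, HasLaw (X i) (densityLaw m M f) P) (hindep : iIndepFun X P)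
    {h : ℕ → ℝ} (hpos : ∀ n, 0 < h n) (h0 : Tendsto h atTop (𝓝 0))
    {β : ℕ → ℝ} (hβ : Tendsto β atTop atTop)
    (hβh : Tendsto (fun n => β n * h n ^ 2) atTop (𝓝 0))
    (hrate : Tendsto (fun n : ℕ => n * h n ^ m / (β n ^ 2 * Real.log n)) atTop atTop)
    {lam : ℝ} (hlam : 0 < lam)
    (hlevel : ∀ x ∈ M, f x = lam → ∃ a : ℕ → Euc d,
      (∀ j, IsInteriorPt m M (a j) ∧ lam < f (a j)) ∧ Tendsto a atTop (𝓝 x))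
    {r : ℝ} (hr : 0 < r) (hconv : IsRConvex M r (levelSet M f lam))
    (hconv_est : ∀ᵐ ω ∂P, ∀ᶠ n in atTop,
      IsRConvex M r (levelSet M (densityEstimator m (h n) n fun i => X i ω) lam)) :
    (∀ᵐ ω ∂P, Tendsto
      (fun n => geodesicHausdorffEDist M
        (rConvexHull M r (samplePointsAbove n (fun i => X i ω)
          (densityEstimator m (h n) n fun i => X i ω) lam))
        (rConvexHull M r (samplePointsAbove n (fun i => X i ω) f lam)))
      atTop (𝓝 0)) ∧
    (∀ᵐ ω ∂P, Tendsto
      (fun n => geodesicHausdorffEDist M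
        (rConvexHull M r (samplePointsAbove n (fun i => X i ω)
          (densityEstimator m (h n) n fun i => X i ω) lam))
        (levelSet M f lam))
      atTop (𝓝 0)) := by
  have hfc : ContinuousOn f M := hf.continuousOn
  set μ := densityLaw m M f with hμ
  have hμprob : IsProbabilityMeasure μ := (hlaw 0).isProbabilityMeasure_iff.1 inferInstance
  have hrate' : Tendsto (fun n : ℕ => n * h n ^ m / Real.log n) atTop atTop := by
    refine tendsto_atTop_mono' atTop ?_ hrate
    filter_upwards [hβ.eventually_ge_atTop 1, eventually_ge_atTop 1] with n hn hn1
    have hlog : 0 ≤ Real.log n := Real.log_natCast_nonneg n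
    have hβ2 : 1 ≤ β n ^ 2 := one_le_pow₀ hn
    have hnum : 0 ≤ n * h n ^ m := mul_nonneg n.cast_nonneg (pow_pos (hpos n) m).le
    rw [mul_comm (β n ^ 2), ← div_div]
    exact div_le_self (div_nonneg hnum hlog) hβ2
  have hh : Tendsto h atTop (𝓝[>] 0) :=
    tendsto_nhdsWithin_iff.2 ⟨h0, Eventually.of_forall hpos⟩
  obtain ⟨C, hC0, hC⟩ : ∃ C : ℝ, 0 < C ∧ ∀ᶠ n in atTop, ∀ x ∈ M, smoothed μ m (h n) x ≤ C := by
    obtain ⟨B, hB⟩ := hM.isCompact.bddAbove_image hfc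
    refine ⟨max B 0 + 1, by positivity, ?_⟩
    filter_upwards [hh.eventually (eventually_smoothed_le_add hM hfc hf0 one_pos)] with n hn x hx
    linarith [hn x hx, hB (mem_image_of_mem f hx), le_max_left B 0]
  -- Countably many tolerances, so that one null set serves all of them; the countable basis in
  -- `hdense` plays the same role.
  have hdev : ∀ᵐ ω ∂P, ∀ k : ℕ, ∀ᶠ n in atTop, ∀ x ∈ M,
      |densityEstimator m (h n) n (fun i => X i ω) x - smoothed μ m (h n) x| ≤
        3 * (1 / ((k : ℝ) + 1)) :=
    ae_all_iff.2 fun k => ae_eventually_abs_densityEstimator_sub_smoothed_le hM hlaw hindep hpos h0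
      hrate' hC0 hC (by positivity)
  have hXM : ∀ᵐ ω ∂P, ∀ i, X i ω ∈ M := ae_all_iff.2 fun i => by
    have hmem : ∀ᵐ x ∂μ, x ∈ M := by
      have := Measure.support_mem_ae (μ := μ)
      rwa [hsupp] at this
    exact ((hlaw i).ae_iff (p := fun x => x ∈ M)
      hM.isCompact.isClosed.measurableSet.mem).2 hmem
  have hdense : ∀ᵐ ω ∂P, ∀ s ∈ TopologicalSpace.countableBasis (Euc d), (s ∩ M).Nonempty →
      ∃ i, X i ω ∈ s := by
    refine (ae_ball_iff (TopologicalSpace.countable_countableBasis _)).2 fun s hs => ?_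
    by_cases hne : (s ∩ M).Nonempty
    · obtain ⟨b, hbs, hbM⟩ := hne
      have hso := TopologicalSpace.isOpen_of_mem_countableBasis hs
      have hpos : 0 < μ s := by
        rw [← hsupp] at hbM
        exact (Measure.mem_support_iff_forall b).1 hbM s (hso.mem_nhds hbs)
      filter_upwards [ae_exists_mem_of_measure_pos hlaw hindep hso.measurableSet hpos.ne']
        with ω hω _ using hω
    · exact Eventually.of_forall fun ω hω => absurd hω hne
  have hcl := hM.levelSet_subset_closure hfc hlevel
  have key : ∀ᵐ ω ∂P,
      (∀ δ > 0, ∀ᶠ n in atTop,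
        (∀ a ∈ rConvexHull M r (samplePointsAbove n (fun i => X i ω)
            (densityEstimator m (h n) n fun i => X i ω) lam),
          ∃ x ∈ levelSet M f lam, dist a x < δ) ∧
        ∀ x ∈ levelSet M f lam, ∃ a ∈ rConvexHull M r (samplePointsAbove n (fun i => X i ω)
            (densityEstimator m (h n) n fun i => X i ω) lam), dist x a < δ) ∧
      (∀ δ > 0, ∀ᶠ n : ℕ in atTop,
        (∀ a ∈ rConvexHull M r (samplePointsAbove n (fun i => X i ω) f lam),
          ∃ x ∈ levelSet M f lam, dist a x < δ) ∧
        ∀ x ∈ levelSet M f lam, ∃ a ∈ rConvexHull M r (samplePointsAbove n (fun i => X i ω) f lam),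
          dist x a < δ) := by
    filter_upwards [hdev, hXM, hdense, hconv_est] with ω hdev hXM hdense hconv_est
    have hdense' : ∀ b ∈ M, ∀ V ∈ 𝓝 b, ∃ i, X i ω ∈ V := fun b hb V hV => by
      obtain ⟨s, hs, hbs, hsV⟩ :=
        (TopologicalSpace.isBasis_countableBasis (Euc d)).mem_nhds_iff.1 hV
      obtain ⟨i, hi⟩ := hdense s hs ⟨b, hbs, hb⟩
      exact ⟨i, hsV hi⟩
    have hdev' : ∀ ε > 0, ∀ᶠ n in atTop, ∀ x ∈ M,
        |densityEstimator m (h n) n (fun i => X i ω) x - smoothed μ m (h n) x| ≤ ε := fun ε hε => by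
      obtain ⟨k, hk⟩ := exists_nat_one_div_lt (show 0 < ε / 3 by positivity)
      filter_upwards [hdev k] with n hn x hx
      linarith [hn x hx]
    have hsub : ∀ (n : ℕ) (g : Euc d → ℝ),
        samplePointsAbove n (fun i => X i ω) g lam ⊆ levelSet M g lam := by
      rintro n g _ ⟨i, -, rfl, hi⟩
      exact ⟨hXM i, hi.le⟩
    have hsubM : ∀ (n : ℕ) (g : Euc d → ℝ), samplePointsAbove n (fun i => X i ω) g lam ⊆ M :=
      fun n g x hx => (hsub n g hx).1
    refine ⟨fun δ hδ => ?_, fun δ hδ => ?_⟩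
    · obtain ⟨ε, hε, hnear⟩ := exists_levelSet_sub_near (lam := lam) hM.isCompact hfc hδ
      have hlow := eventually_exists_samplePointsAbove_near hM.isCompact hfc hcl hXM hdense'
        (g := fun n => densityEstimator m (h n) n fun i => X i ω) (fun b hb hfb => by
          -- Bias and deviation each cost a third of the gap, which keeps the estimator above `lam`.
          have hη : 0 < (f b - lam) / 3 := by linarith
          obtain ⟨U, hU, hUh⟩ := eventually_le_smoothed hM hfc hb (hlam.trans hfb) hη
          refine ⟨U, hU, ?_⟩
          filter_upwards [hh.eventually hUh, hdev' _ hη] with n h1 h2 x hx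
          linarith [h1 x hx, (abs_le.1 (h2 x hx.2)).1]) hδ
      filter_upwards [hlow, hconv_est, hdev' (ε / 2) (by positivity),
        hh.eventually (eventually_smoothed_le_add hM hfc hf0 (show 0 < ε / 2 by positivity))]
        with n hn hcn h1 h2
      refine ⟨fun a ha => ?_, fun x hx => ?_⟩
      · have ha' := rConvexHull_mono (hsub n _) ha
        rw [← hcn] at ha'
        exact hnear a ha'.1 (by
          linarith [h2 a ha'.1, (abs_le.1 (h1 a ha'.1)).2, ha'.2])
      · obtain ⟨y, hy, hxy⟩ := hn x hx
        exact ⟨y, subset_rConvexHull (hsubM n _) hy, hxy⟩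
    · have hlow := eventually_exists_samplePointsAbove_near hM.isCompact hfc hcl hXM hdense'
        (g := fun _ => f) (fun b hb hfb => by
          have h2 : ∀ᶠ y in 𝓝[M] b, lam < f y := (hfc b hb.1).eventually_const_lt hfb
          rw [eventually_nhdsWithin_iff] at h2
          exact ⟨_, h2, Eventually.of_forall fun _ x hx => hx.1 hx.2⟩) hδ
      filter_upwards [hlow] with n hn
      refine ⟨fun a ha => ?_, fun x hx => ?_⟩
      · have ha' := rConvexHull_mono (hsub n f) ha
        rw [← hconv] at ha'
        exact ⟨a, ha', by rwa [dist_self]⟩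
      · obtain ⟨y, hy, hxy⟩ := hn x hx
        exact ⟨y, subset_rConvexHull (hsubM n f) hy, hxy⟩
  have hhullM : ∀ A : Set (Euc d), rConvexHull M r A ⊆ M := fun A x hx => hx.1
  refine ⟨?_, ?_⟩
  · filter_upwards [key] with ω hω
    exact hM.tendsto_geodesicHausdorffEDist (fun n => hhullM _) (fun n => hhullM _) hω.1 hω.2
  · filter_upwards [key] with ω hω
    exact hM.tendsto_geodesicHausdorffEDist (fun n => hhullM _) (fun n x hx => hx.1) hω.1
      fun δ hδ => Eventually.of_forall fun n =>
        ⟨fun c hc => ⟨c, hc, by rwa [dist_self]⟩, fun x hx => ⟨x, hx, by rwa [dist_self]⟩⟩
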